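/- Let $S_n$ be the set of permutations of $[n]=\{1,\dots,n\}$, and call $\pi\in S_n$ cyclic if it consists of exactly one cycle, of length $n$. The one-line form of $\pi$ is the word $\pi(1)\pi(2)\cdots\pi(n)$, and the cycle form of a cyclic $\pi$ is $C(\pi)=(c_1,c_2,\dots,c_n)$, where $c_1=1$ and $c_i=\pi(c_{i-1})$ for $2\le i\le n$. A word $w_1\cdots w_n$ avoids a pattern $\sigma\in S_k$ if there are no indices $i_1<\dots<i_k$ such that $w_{i_1},\dots,w_{i_k}$ are in the same relative order as $\sigma(1),\dots,\sigma(k)$. Let $a_n(\sigma;\tau)$ be the number of cyclic permutations in $S_n$ whose one-line form avoids $\sigma$ and whose cycle form avoids $\tau$. (i) If $n\ge 1$ and $\pi\in S_n$ is cyclic with $C(\pi)=(1,c_2,\dots,c_n)$, then $C(\pi^{-1})=(1,c_n,c_{n-1},\dots,c_2)$, the reversal of $C(\pi)$ up to cyclic rotation. (ii) For all $n\ge 1$ and every pattern $\sigma$ (of any length), $a_n(\sigma;312)=a_n(\sigma^{-1};213)$. (iii) For all $n\ge 5$, \[ a_n(\sigma;312)=\begin{cases} \lceil n/2\rceil+1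 & \text{if } \sigma=123,\\ n-1 & \text{if } \sigma=132,\\ F_n & \text{if } \sigma=213,\\ 1 & \text{if } \sigma=231,\\ \displaystyle\sum_{k=0}^{\lfloor (n-1)/3\rfloor}\binom{n-1-k}{2k} & \text{if } \sigma=312,\\ 2^{n-2} & \text{if } \sigma=321, \end{cases} \] where $F_n$ is the $n$-th Fibonacci number, with $F_1=F_2=1$. -/

import Mathlib

/- Permutations of `[n] = {1, …, n}` are elements of `Equiv.Perm (Fin n)`: the element `i` of
`Fin n` stands for the number `i + 1`, so `0 : Fin n` is the number `1`. -/

namespace CyclicAvoid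

/-- The permutation `π` of `[n]` consists of exactly one cycle, which contains all of `[n]`
(for `n = 1` the identity qualifies). -/
def IsCyclic {n : ℕ} (π : Equiv.Perm (Fin n)) : Prop :=
  π.IsCycleOn Set.univ

/-- The cycle form `C(π) = (c₁, …, cₙ)` as a word: `c₁ = 1` and `cᵢ = π(cᵢ₋₁)`, that is
`cᵢ₊₁ = πⁱ(1)`; the letter at the (zero-based) position `i` is `cᵢ₊₁`. -/
def cycleForm {n : ℕ} (π : Equiv.Perm (Fin n)) (i : Fin n) : Fin n :=
  (π ^ (i : ℕ)) ⟨0, i.pos⟩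

/-- The word `w = w₁ … wₙ` avoids the pattern `σ ∈ Sₖ`: there are no positions `i₁ < ⋯ < iₖ` such
that `w_{i₁} … w_{iₖ}` is in the same relative order as `σ₁ … σₖ`. -/
def Avoids {n k : ℕ} (w : Fin n → Fin n) (σ : Equiv.Perm (Fin k)) : Prop :=
  ¬ ∃ p : Fin k → Fin n, StrictMono p ∧ ∀ a b : Fin k, w (p a) < w (p b) ↔ σ a < σ b

/-- `𝒜ₙ(σ; τ)`: the cyclic permutations of `[n]` that avoid `σ` in one-line form and `τ` in cycle
form. -/
def avoiders (n : ℕ) {k l : ℕ} (σ : Equiv.Perm (Fin k)) (τ : Equiv.Perm (Fin l)) :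
    Set (Equiv.Perm (Fin n)) :=
  {π | IsCyclic π ∧ Avoids (fun i => π i) σ ∧ Avoids (cycleForm π) τ}

/-- `aₙ(σ; τ) = |𝒜ₙ(σ; τ)|`. -/
noncomputable def numAvoiders (n : ℕ) {k l : ℕ} (σ : Equiv.Perm (Fin k))
    (τ : Equiv.Perm (Fin l)) : ℕ :=
  (avoiders n σ τ).ncard

/-- The pattern 123. -/
def p123 : Equiv.Perm (Fin 3) := ⟨![0, 1, 2], ![0, 1, 2], by decide, by decide⟩

/-- The pattern 132. -/
def p132 : Equiv.Perm (Fin 3) := ⟨![0, 2, 1], ![0, 2, 1], by decide, by decide⟩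

/-- The pattern 213. -/
def p213 : Equiv.Perm (Fin 3) := ⟨![1, 0, 2], ![1, 0, 2], by decide, by decide⟩

/-- The pattern 231. -/
def p231 : Equiv.Perm (Fin 3) := ⟨![1, 2, 0], ![2, 0, 1], by decide, by decide⟩

/-- The pattern 312. -/
def p312 : Equiv.Perm (Fin 3) := ⟨![2, 0, 1], ![1, 2, 0], by decide, by decide⟩

/-- The pattern 321. -/
def p321 : Equiv.Perm (Fin 3) := ⟨![2, 1, 0], ![2, 1, 0], by decide, by decide⟩

end CyclicAvoid

/-! Letters are counted from 0. Inverting a cyclic permutation reverses its cycle form after the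
leading 0. That 0 can open neither a 312 nor a 213, so the reversal exchanges these two patterns,
while a one-line pattern σ turns into σ⁻¹; this settles (i) and (ii).

For (iii) a permutation is replaced by its cycle word c, where the letter c i is sent to c (i + 1).
Two consequences of avoiding 312 are used throughout: the letters below c 1 occur in decreasing
order (`lt_of_lt_apply_one`), and every letter after the letter 1 exceeds c 1
(`apply_one_lt_of_lt`). For each σ the position of the letter 1 or of the largest letter is then
forced.

For 231 the largest letter comes right after 0, which leaves only the decreasing word. For 321 the
letter 1 is next to 0 or at the end, and deleting it halves the count. For 213 every word but the
decreasing one ends in its largest letter, and either begins 0, 1 or has 1 just before the end;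
deletion gives the Fibonacci recurrence. For 132 only the words `stairWord` survive.

For 312 the word is a zigzag on an initial interval of letters followed by a shifted avoiding word;
the resulting recurrence is also satisfied by the binomial sum. For 123 a word ending in 1 is the
full zigzag, a word ending in its largest letter has 1 just before it and loses both letters, and
any other word is one of two sporadic ones, of lengths 4 and 5. -/

namespace CyclicAvoid

/-! ### The cycle form and its inverse -/

lemma IsCyclic.pow_apply_eq_pow_apply {n : ℕ} {π : Equiv.Perm (Fin n)} (h : IsCyclic π)
    (x : Fin n) {a b : ℕ} : (π ^ a) x = (π ^ b) x ↔ a ≡ b [MOD n] := by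
  have h' : π.IsCycleOn ((Finset.univ : Finset (Fin n)) : Set (Fin n)) := by
    simpa [IsCyclic] using h
  have := h'.pow_apply_eq_pow_apply (Finset.mem_univ x) (m := a) (n := b)
  simpa using this

lemma IsCyclic.pow_card_apply {n : ℕ} {π : Equiv.Perm (Fin n)} (h : IsCyclic π)
    (x : Fin n) : (π ^ n) x = x := by
  have := (h.pow_apply_eq_pow_apply x (a := n) (b := 0)).2 (by simp [Nat.ModEq])
  simpa using this

/-- For positions below n the divisibility says that j = n - i or that both are 0, so it expresses
the reversal that keeps the leading letter in place. -/
lemma cycleForm_inv {n : ℕ} {π : Equiv.Perm (Fin n)} (h : IsCyclic π) (i j : Fin n)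
    (hij : n ∣ (i : ℕ) + (j : ℕ)) : cycleForm π⁻¹ i = cycleForm π j := by
  unfold cycleForm
  rw [inv_pow, Equiv.Perm.inv_eq_iff_eq, ← Equiv.Perm.mul_apply, ← pow_add]
  have := (h.pow_apply_eq_pow_apply ⟨0, i.pos⟩ (a := 0) (b := i + j)).2
    ((Nat.modEq_zero_iff_dvd.2 hij).symm)
  simpa using this

lemma cycleForm_injective {n : ℕ} {π : Equiv.Perm (Fin n)} (h : IsCyclic π) :
    Function.Injective (cycleForm π) := by
  intro i j hij
  have := (h.pow_apply_eq_pow_apply ⟨0, i.pos⟩).1 hij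
  exact Fin.ext (Nat.ModEq.eq_of_lt_of_lt this i.2 j.2)

lemma cycleForm_eq_zero_iff {n : ℕ} {π : Equiv.Perm (Fin n)} (h : IsCyclic π) (i : Fin n) :
    (cycleForm π i : ℕ) = 0 ↔ (i : ℕ) = 0 := by
  have h0 : cycleForm π ⟨0, i.pos⟩ = ⟨0, i.pos⟩ := by simp [cycleForm]
  constructor
  · intro hi
    have : cycleForm π i = cycleForm π ⟨0, i.pos⟩ := by rw [h0]; exact Fin.ext hi
    have := cycleForm_injective h this
    simp [this]
  · intro hi
    have : i = ⟨0, i.pos⟩ := Fin.ext hi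
    rw [this, h0]

/-! ### Patterns of length three as order relations -/

/-- `P` describes the relative order of the three letters of the pattern `σ`. -/
def Describes (P : ℕ → ℕ → ℕ → Prop) (σ : Equiv.Perm (Fin 3)) : Prop :=
  ∀ v : Fin 3 → ℕ, (∀ a b, v a < v b ↔ σ a < σ b) ↔ P (v 0) (v 1) (v 2)

/-- `x, y, z` are in the relative order 123. -/
abbrev Ord123 (x y z : ℕ) : Prop := x < y ∧ y < z

/-- `x, y, z` are in the relative order 132. -/
abbrev Ord132 (x y z : ℕ) : Prop := x < z ∧ z < y

/-- `x, y, z` are in the relative order 213. -/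
abbrev Ord213 (x y z : ℕ) : Prop := y < x ∧ x < z

/-- `x, y, z` are in the relative order 231. -/
abbrev Ord231 (x y z : ℕ) : Prop := z < x ∧ x < y

/-- `x, y, z` are in the relative order 312. -/
abbrev Ord312 (x y z : ℕ) : Prop := y < z ∧ z < x

/-- `x, y, z` are in the relative order 321. -/
abbrev Ord321 (x y z : ℕ) : Prop := z < y ∧ y < x

lemma describes_p123 : Describes Ord123 p123 := by
  intro v; simp [Fin.forall_fin_succ, p123]; omega

lemma describes_p132 : Describes Ord132 p132 := by
  intro v; simp [Fin.forall_fin_succ, p132]; omega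

lemma describes_p213 : Describes Ord213 p213 := by
  intro v; simp [Fin.forall_fin_succ, p213]; omega

lemma describes_p231 : Describes Ord231 p231 := by
  intro v; simp [Fin.forall_fin_succ, p231]; omega

lemma describes_p312 : Describes Ord312 p312 := by
  intro v; simp [Fin.forall_fin_succ, p312]; omega

lemma describes_p321 : Describes Ord321 p321 := by
  intro v; simp [Fin.forall_fin_succ, p321]; omega

lemma Describes.avoids_iff {P : ℕ → ℕ → ℕ → Prop} {σ : Equiv.Perm (Fin 3)} (hP : Describes P σ)
    {n : ℕ} (w : Fin n → Fin n) :
    Avoids w σ ↔ ∀ i j k : Fin n, i < j → j < k → ¬ P (w i) (w j) (w k) := by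
  unfold Avoids
  constructor
  · intro h i j k hij hjk hp
    refine h ⟨![i, j, k], ?_, ?_⟩
    · intro a b hab
      fin_cases a <;> fin_cases b <;> simp_all
      exact hij.trans hjk
    · intro a b
      have := (hP (fun a => (w (![i, j, k] a) : ℕ))).2 (by simpa using hp) a b
      simpa using this
  · rintro h ⟨p, hp, hw⟩
    refine h (p 0) (p 1) (p 2) (hp (by decide)) (hp (by decide)) ?_
    exact (hP (fun a => (w (p a) : ℕ))).1 (fun a b => by simpa using hw a b)

/-! ### The symmetry under inversion -/

/-- In the permutation matrix inversion swaps positions and values: the values of an occurrence,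
sorted, become the positions of the inverse occurrence. -/
lemma Avoids.inv {n k : ℕ} {π : Equiv.Perm (Fin n)} {σ : Equiv.Perm (Fin k)}
    (h : Avoids (fun i => π i) σ) : Avoids (fun i => π⁻¹ i) σ⁻¹ := by
  rintro ⟨p, hp, hw⟩
  refine h ⟨fun a => π⁻¹ (p (σ a)), ?_, ?_⟩
  · intro a b hab
    rw [hw]
    simpa using hab
  · intro a b
    simpa using hp.lt_iff_lt

/-- The map i ↦ n - i reverses the nonzero positions. Position 0 carries the least letter, which is
not the first letter of a 312 or of a 213, so it never takes part. -/
lemma avoids_cycleForm_inv_iff {n : ℕ} {π : Equiv.Perm (Fin n)} (h : IsCyclic π) :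
    Avoids (cycleForm π⁻¹) p213 ↔ Avoids (cycleForm π) p312 := by
  rw [describes_p213.avoids_iff, describes_p312.avoids_iff]
  have key : ∀ i : Fin n, 0 < (i : ℕ) → ∃ j : Fin n, (j : ℕ) = n - i ∧
      cycleForm π⁻¹ i = cycleForm π j ∧ cycleForm π⁻¹ j = cycleForm π i := by
    intro i hi
    have h1 : (i : ℕ) + (n - i) = n := by omega
    have h2 : (n - i) + (i : ℕ) = n := by omega
    refine ⟨⟨n - i, by omega⟩, rfl, cycleForm_inv h _ _ ?_, cycleForm_inv h _ _ ?_⟩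
    · simp
    · simp
  have h' : IsCyclic π⁻¹ := Equiv.Perm.IsCycleOn.inv h
  constructor
  · intro H i j k hij hjk hp
    have hi0 : 0 < (i : ℕ) := by
      by_contra h0
      have := (cycleForm_eq_zero_iff h i).2 (by omega)
      omega
    have hij' : (i : ℕ) < j := hij
    have hjk' : (j : ℕ) < k := hjk
    obtain ⟨i', hi', -, ei⟩ := key i hi0
    obtain ⟨j', hj', -, ej⟩ := key j (by omega)
    obtain ⟨k', hk', -, ek⟩ := key k (by omega)
    refine H k' j' i' (Fin.lt_def.2 (by omega)) (Fin.lt_def.2 (by omega)) ?_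
    rw [ei, ej, ek]; exact hp
  · intro H i j k hij hjk hp
    have hi0 : 0 < (i : ℕ) := by
      by_contra h0
      have := (cycleForm_eq_zero_iff h' i).2 (by omega)
      omega
    have hij' : (i : ℕ) < j := hij
    have hjk' : (j : ℕ) < k := hjk
    obtain ⟨i', hi', ei, -⟩ := key i hi0
    obtain ⟨j', hj', ej, -⟩ := key j (by omega)
    obtain ⟨k', hk', ek, -⟩ := key k (by omega)
    refine H k' j' i' (Fin.lt_def.2 (by omega)) (Fin.lt_def.2 (by omega)) ?_
    rw [← ei, ← ej, ← ek]; exact hp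

lemma inv_mem_avoiders_iff {n k : ℕ} (σ : Equiv.Perm (Fin k)) (π : Equiv.Perm (Fin n)) :
    π⁻¹ ∈ avoiders n σ⁻¹ p213 ↔ π ∈ avoiders n σ p312 := by
  constructor
  · rintro ⟨h1, h2, h3⟩
    have h1' : IsCyclic π := Equiv.Perm.isCycleOn_inv.1 h1
    exact ⟨h1', by simpa using h2.inv, (avoids_cycleForm_inv_iff h1').1 h3⟩
  · rintro ⟨h1, h2, h3⟩
    exact ⟨Equiv.Perm.IsCycleOn.inv h1, h2.inv, (avoids_cycleForm_inv_iff h1).2 h3⟩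

lemma numAvoiders_p312_eq_p213 (n : ℕ) {k : ℕ} (σ : Equiv.Perm (Fin k)) :
    numAvoiders n σ p312 = numAvoiders n σ⁻¹ p213 := by
  refine Set.ncard_congr (fun π _ => π⁻¹) (fun π hπ => (inv_mem_avoiders_iff σ π).2 hπ)
    (fun _ _ _ _ h => inv_injective h) (fun π hπ => ⟨π⁻¹, ?_, inv_inv π⟩)
  rw [← inv_mem_avoiders_iff, inv_inv]
  exact hπ

/-! ### Cycle words -/

/-- The cycle form of a cyclic permutation of `[n]`, as a sequence of natural numbers that is
zero from the index `n` on. -/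
structure IsCycleWord (n : ℕ) (c : ℕ → ℕ) : Prop where
  zero : c 0 = 0
  tail : ∀ i, n ≤ i → c i = 0
  lt : ∀ i, i < n → c i < n
  inj : ∀ i j, i < n → j < n → c i = c j → i = j

/-- The cycle forms avoiding 312 of cyclic permutations whose one-line form avoids the pattern
described by `P`; the permutation sends `c i` to `c (i + 1)`. -/
structure IsAvoidingWord (P : ℕ → ℕ → ℕ → Prop) (n : ℕ) (c : ℕ → ℕ) : Prop
    extends IsCycleWord n c where
  cyc : ∀ i j k, i < j → j < k → k < n → ¬ (c j < c k ∧ c k < c i)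
  oneLine : ∀ i j k, i < n → j < n → k < n → c i < c j → c j < c k →
    ¬ P (c (i + 1)) (c (j + 1)) (c (k + 1))

/-- The cycle form, extended by zeros. -/
def word {n : ℕ} (π : Equiv.Perm (Fin n)) (i : ℕ) : ℕ :=
  if h : i < n then cycleForm π ⟨i, h⟩ else 0

lemma word_of_lt {n : ℕ} (π : Equiv.Perm (Fin n)) {i : ℕ} (h : i < n) :
    word π i = cycleForm π ⟨i, h⟩ := by
  simp [word, h]

lemma word_succ {n : ℕ} {π : Equiv.Perm (Fin n)} (hπ : IsCyclic π) {i : ℕ} (h : i < n) :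
    word π (i + 1) = π (cycleForm π ⟨i, h⟩) := by
  have e : π (cycleForm π ⟨i, h⟩) = (π ^ (i + 1)) ⟨0, by omega⟩ := by
    simp [cycleForm, pow_succ']
  rw [e]
  by_cases h1 : i + 1 < n
  · simp [word, h1, cycleForm]
  · have : i + 1 = n := by omega
    simp [word, this, hπ.pow_card_apply]

lemma isCycleWord_word {n : ℕ} {π : Equiv.Perm (Fin n)} (hπ : IsCyclic π) :
    IsCycleWord n (word π) where
  zero := by
    by_cases h : 0 < n
    · simp [word, h, cycleForm]
    · simp [word, h]
  tail i hi := by simp [word, Nat.not_lt.2 hi]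
  lt i hi := by simp [word, hi]
  inj i j hi hj hij := by
    rw [word_of_lt _ hi, word_of_lt _ hj] at hij
    simpa using cycleForm_injective hπ (Fin.ext hij)

lemma word_injOn {n : ℕ} : Set.InjOn (word (n := n)) {π | IsCyclic π} := by
  intro π hπ ρ hρ h
  have hc : cycleForm π = cycleForm ρ := by
    funext i
    have := congrFun h i
    rw [word_of_lt _ i.2, word_of_lt _ i.2] at this
    exact Fin.ext this
  ext x
  obtain ⟨i, rfl⟩ := (Finite.injective_iff_surjective.1 (cycleForm_injective hπ)) x
  have := congrFun h (i + 1)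
  rw [word_succ hπ i.2, word_succ hρ i.2] at this
  simpa [hc] using this

/-- The permutation is the rotation of the positions conjugated by the bijection from positions to
letters. -/
lemma exists_word_eq {n : ℕ} {c : ℕ → ℕ} (hc : IsCycleWord n c) :
    ∃ π : Equiv.Perm (Fin n), IsCyclic π ∧ word π = c := by
  rcases n with _ | m
  · refine ⟨1, ?_, funext fun i => ?_⟩
    · exact ⟨Set.bijOn_univ.2 (Equiv.bijective _), fun x => x.elim0⟩
    · simp [word, hc.tail]
  let e₀ : Fin (m + 1) → Fin (m + 1) := fun i => ⟨c i, hc.lt i i.2⟩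
  have he₀ : Function.Injective e₀ := by
    intro i j h
    exact Fin.ext (hc.inj i j i.2 j.2 (by simpa [e₀] using h))
  let e : Equiv.Perm (Fin (m + 1)) := Equiv.ofBijective e₀ (Finite.injective_iff_bijective.1 he₀)
  let π : Equiv.Perm (Fin (m + 1)) := e * finRotate (m + 1) * e⁻¹
  have hpow : ∀ i (h : i < m + 1), (π ^ i) 0 = e ⟨i, h⟩ := by
    intro i
    induction i with
    | zero =>
      intro h
      exact Fin.ext hc.zero.symm
    | succ i ih =>
      intro h
      rw [pow_succ', Equiv.Perm.mul_apply, ih (by omega)]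
      simp only [π, Equiv.Perm.mul_apply, Equiv.Perm.inv_def, Equiv.symm_apply_apply]
      exact congrArg e (finRotate_of_lt (by omega))
  refine ⟨π, ⟨Set.bijOn_univ.2 (Equiv.bijective _), ?_⟩, ?_⟩
  · have h0 : ∀ x, π.SameCycle 0 x := by
      intro x
      obtain ⟨i, rfl⟩ := e.surjective x
      exact ⟨(i : ℕ), by simpa using hpow i i.2⟩
    intro x _ y _
    exact (h0 x).symm.trans (h0 y)
  · funext i
    by_cases h : i < m + 1
    · rw [word_of_lt _ h]
      exact congrArg Fin.val (hpow i h)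
    · simp [word, h, hc.tail i (by omega)]

lemma isAvoidingWord_word_iff {P : ℕ → ℕ → ℕ → Prop} {σ : Equiv.Perm (Fin 3)}
    (hP : Describes P σ) {n : ℕ} {π : Equiv.Perm (Fin n)} (hπ : IsCyclic π) :
    IsAvoidingWord P n (word π) ↔ π ∈ avoiders n σ p312 := by
  have hs := Finite.injective_iff_surjective.1 (cycleForm_injective hπ)
  simp only [avoiders, Set.mem_ofPred_eq, hP.avoids_iff, describes_p312.avoids_iff, hπ, true_and]
  constructor
  · intro h
    constructor
    · intro x y z hxy hyz
      obtain ⟨i, rfl⟩ := hs x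
      obtain ⟨j, rfl⟩ := hs y
      obtain ⟨k, rfl⟩ := hs z
      have := h.oneLine i j k i.2 j.2 k.2
      rw [word_of_lt _ i.2, word_of_lt _ j.2, word_of_lt _ k.2, word_succ hπ i.2,
        word_succ hπ j.2, word_succ hπ k.2] at this
      exact this hxy hyz
    · intro i j k hij hjk
      have := h.cyc i j k hij hjk k.2
      rwa [word_of_lt _ i.2, word_of_lt _ j.2, word_of_lt _ k.2] at this
  · rintro ⟨h1, h2⟩
    refine ⟨isCycleWord_word hπ, ?_, ?_⟩
    · intro i j k hij hjk hk
      rw [word_of_lt _ hk, word_of_lt _ (hjk.trans hk), word_of_lt _ (hij.trans (hjk.trans hk))]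
      exact h2 _ _ _ hij hjk
    · intro i j k hi hj hk
      rw [word_of_lt _ hi, word_of_lt _ hj, word_of_lt _ hk, word_succ hπ hi, word_succ hπ hj,
        word_succ hπ hk]
      exact h1 _ _ _

/-- The zero extension makes the successor of the last letter equal to 0, as the cycle requires, so
counting words is counting permutations. -/
lemma numAvoiders_eq_ncard {P : ℕ → ℕ → ℕ → Prop} {σ : Equiv.Perm (Fin 3)}
    (hP : Describes P σ) (n : ℕ) :
    numAvoiders n σ p312 = {c | IsAvoidingWord P n c}.ncard := by
  have : {c | IsAvoidingWord P n c} = word '' avoiders n σ p312 := by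
    ext c
    constructor
    · intro h
      obtain ⟨π, hπ, rfl⟩ := exists_word_eq h.toIsCycleWord
      exact ⟨π, (isAvoidingWord_word_iff hP hπ).1 h, rfl⟩
    · rintro ⟨π, hπ, rfl⟩
      exact (isAvoidingWord_word_iff hP hπ.1).2 hπ
  rw [this, (word_injOn.mono fun π hπ => hπ.1).ncard_image]
  rfl

lemma finite_setOf_isCycleWord (n : ℕ) : {c | IsCycleWord n c}.Finite := by
  refine (Set.finite_range (word (n := n))).subset ?_
  intro c hc
  obtain ⟨π, -, rfl⟩ := exists_word_eq hc
  exact ⟨π, rfl⟩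

lemma finite_setOf_isAvoidingWord (P : ℕ → ℕ → ℕ → Prop) (n : ℕ) :
    {c | IsAvoidingWord P n c}.Finite :=
  (finite_setOf_isCycleWord n).subset fun _ h => h.toIsCycleWord

lemma exists_crossing (p : ℕ → Prop) {a b : ℕ} (hab : a ≤ b) (ha : p a) (hb : ¬ p b) :
    ∃ i, a ≤ i ∧ i < b ∧ p i ∧ ¬ p (i + 1) := by
  by_contra! h
  have key : ∀ m, a ≤ m → m ≤ b → p m := by
    intro m hm
    induction m, hm using Nat.le_induction with
    | base => exact fun _ => ha
    | succ m hm ih => exact fun hmb => h m hm hmb (ih (by omega))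
  exact hb (key b hab le_rfl)

/-! ### Consequences of avoiding 312 in the cycle word -/

namespace IsCycleWord

variable {n : ℕ} {c : ℕ → ℕ}

lemma exists_eq (h : IsCycleWord n c) {x : ℕ} (hx : x < n) : ∃ i, i < n ∧ c i = x := by
  have hinj : Function.Injective (fun i : Fin n => (⟨c i, h.lt i i.2⟩ : Fin n)) := by
    intro i j hij
    exact Fin.ext (h.inj i j i.2 j.2 (by simpa using hij))
  obtain ⟨i, hi⟩ := Finite.injective_iff_surjective.1 hinj ⟨x, hx⟩
  exact ⟨i, i.2, by simpa using hi⟩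

lemma pos (h : IsCycleWord n c) {i : ℕ} (hi : 0 < i) (hin : i < n) : 0 < c i := by
  by_contra h0
  have := h.inj i 0 hin (by omega) (by rw [h.zero]; omega)
  omega

lemma ne (h : IsCycleWord n c) {i j : ℕ} (hi : i < n) (hj : j < n) (hij : i ≠ j) :
    c i ≠ c j := fun e => hij (h.inj i j hi hj e)

lemma exists_succ_eq (h : IsCycleWord n c) {x : ℕ} (hx : 0 < x) (hxn : x < n) :
    ∃ i, i + 1 < n ∧ c (i + 1) = x := by
  obtain ⟨i, hi, rfl⟩ := h.exists_eq hxn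
  rcases i with _ | i
  · simp [h.zero] at hx
  · exact ⟨i, hi, rfl⟩

lemma apply_end (h : IsCycleWord n c) : c n = 0 := h.tail n le_rfl

end IsCycleWord

namespace IsAvoidingWord

variable {P : ℕ → ℕ → ℕ → Prop} {n : ℕ} {c : ℕ → ℕ}

/-- Two increasing letters below c 1 would form a 312 with c 1. -/
lemma lt_of_lt_apply_one (h : IsAvoidingWord P n c) {i j : ℕ} (hi : 0 < i) (hij : i < j)
    (hj : j < n) (hc : c j < c 1) : c j < c i := by
  have := h.ne hj (by omega : i < n) (by omega)
  rcases Nat.eq_or_lt_of_le (Nat.succ_le_of_lt hi) with rfl | hi1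
  · exact hc
  · have := h.cyc 1 i j hi1 hij hj
    omega

/-- A later letter below c 1 would have to be smaller than the letter 1, since letters below c 1
decrease; but it is not 0. -/
lemma apply_one_lt_of_lt (h : IsAvoidingWord P n c) {t i : ℕ} (ht : c t = 1) (hti : t < i)
    (hi : i < n) : c 1 < c i := by
  have ht0 : 0 < t := by
    rcases Nat.eq_zero_or_pos t with rfl | h0
    · rw [h.zero] at ht; omega
    · exact h0
  by_contra hlt
  have := h.ne hi (by omega : 1 < n) (by omega)
  have := h.lt_of_lt_apply_one ht0 hti hi (by omega)
  have := h.pos (by omega) hi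
  omega

/-- The word `0, n - 1, n - 2, …, 1`. -/
def _root_.CyclicAvoid.decWord (n i : ℕ) : ℕ := if i = 0 then 0 else n - i

lemma eq_decWord (h : IsAvoidingWord P n c) (hn : 2 ≤ n) (h1 : c 1 = n - 1) : c = decWord n := by
  have hdec : ∀ i, 1 ≤ i → i + 1 < n → c (i + 1) < c i := by
    intro i hi hin
    refine h.lt_of_lt_apply_one hi (by omega) hin ?_
    have := h.lt _ hin
    have := h.ne hin (by omega : 1 < n) (by omega)
    omega
  have hup : ∀ i, 1 ≤ i → i < n → c i ≤ n - i := by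
    intro i hi
    induction i, hi using Nat.le_induction with
    | base => intro _; omega
    | succ i hi ih =>
      intro hin
      have := hdec i hi hin
      have := ih (by omega)
      omega
  have hlo : ∀ e, e + 1 < n → e + 1 ≤ c (n - 1 - e) := by
    intro e
    induction e with
    | zero => intro he; exact h.pos (by omega) (by omega)
    | succ e ih =>
      intro he
      have := hdec (n - 1 - (e + 1)) (by omega) (by omega)
      have := ih (by omega)
      rw [show n - 1 - (e + 1) + 1 = n - 1 - e by omega] at *
      omega
  funext i
  unfold decWord
  split_ifs with hi
  · rw [hi, h.zero]
  · by_cases hin : i < n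
    · have := hup i (by omega) hin
      have := hlo (n - 1 - i) (by omega)
      rw [show n - 1 - (n - 1 - i) = i by omega] at this
      omega
    · rw [h.tail i (by omega)]; omega

end IsAvoidingWord

/-- The one-line form is n - 1, 0, 1, …, n - 2, so three of its entries, read in order, are in the
order 123 or 312. -/
lemma isAvoidingWord_decWord {P : ℕ → ℕ → ℕ → Prop} {n : ℕ}
    (hP : ∀ x y z, x < y → y < z → ¬ P x y z ∧ ¬ P z x y) : IsAvoidingWord P n (decWord n) where
  zero := rfl
  tail i hi := by unfold decWord; split_ifs <;> omega
  lt i hi := by unfold decWord; split_ifs <;> omega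
  inj i j hi hj := by unfold decWord; split_ifs <;> omega
  cyc i j k hij hjk hk := by unfold decWord; split_ifs <;> omega
  oneLine i j k hi hj hk hij hjk := by
    have key : ∀ i, 0 < i → i < n → decWord n (i + 1) + 1 = decWord n i := by
      intro i h0 hi; rw [decWord, decWord, if_neg (by omega), if_neg (by omega)]; omega
    have hpos : ∀ i, i < n → 0 < decWord n i → 0 < i := by
      intro i hi h; by_contra h0; simp [decWord, show i = 0 by omega] at h
    have hj0 := key j (hpos j hj (by omega)) hj
    have hk0 := key k (hpos k hk (by omega)) hk
    have hle : decWord n k < n := by unfold decWord; split_ifs <;> omega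
    rcases Nat.eq_zero_or_pos i with rfl | hi0
    · have : decWord n (0 + 1) = n - 1 := by simp [decWord]
      exact (hP _ _ _ (by omega) (by omega)).2
    · have := key i hi0 hi
      exact (hP _ _ _ (by omega) (by omega)).1

/-! ### Inserting and deleting letters -/

/-- The word `0, 1, c 1 + 1, …, c (n - 1) + 1` obtained from `0, c 1, …, c (n - 1)`. -/
def consWord (n : ℕ) (c : ℕ → ℕ) (i : ℕ) : ℕ := if i = 0 ∨ n < i then 0 else c (i - 1) + 1

/-- The word `0, c 1 + 1, …, c (n - 1) + 1, 1` obtained from `0, c 1, …, c (n - 1)`. -/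
def snocWord (n : ℕ) (c : ℕ → ℕ) (i : ℕ) : ℕ := if i = 0 ∨ n < i then 0 else c i + 1

/-- The word `0, c 1 + 1, …, c (n - 1) + 1, 1, n + 1` obtained from `0, c 1, …, c (n - 1)`. -/
def snocSnocWord (n : ℕ) (c : ℕ → ℕ) (i : ℕ) : ℕ := if i = n + 1 then n + 1 else snocWord n c i

lemma consWord_injOn (n : ℕ) : Set.InjOn (consWord n) {c | IsCycleWord n c} := by
  intro c hc d hd h
  funext i
  by_cases hi : i < n
  · have := congrFun h (i + 1)
    simpa [consWord, show ¬ n < i + 1 by omega] using this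
  · rw [hc.tail i (by omega), hd.tail i (by omega)]

lemma snocWord_injOn (n : ℕ) : Set.InjOn (snocWord n) {c | IsCycleWord n c} := by
  intro c hc d hd h
  funext i
  by_cases hi : 0 < i ∧ i < n
  · have := congrFun h i
    simpa [snocWord, show ¬ (i = 0 ∨ n < i) by omega] using this
  · rcases Nat.eq_zero_or_pos i with rfl | h0
    · rw [hc.zero, hd.zero]
    · rw [hc.tail i (by omega), hd.tail i (by omega)]

lemma snocSnocWord_injOn (n : ℕ) : Set.InjOn (snocSnocWord n) {c | IsCycleWord n c} := by
  intro c hc d hd h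
  refine snocWord_injOn n hc hd (funext fun i => ?_)
  have := congrFun h i
  unfold snocSnocWord at this
  split_ifs at this with hi
  · simp [snocWord, hi]
  · exact this

/-- In one-line form a new first entry 1 appears and the old entries are relabelled by 0 ↦ 0, x ↦ x
+ 1, which is strictly monotone. Only occurrences that begin with the new entry remain to be
excluded, which is the hypothesis `h1`. -/
lemma isAvoidingWord_consWord {P : ℕ → ℕ → ℕ → Prop} {n : ℕ} {c : ℕ → ℕ} (hn : 0 < n)
    (hP : ∀ φ : ℕ → ℕ, StrictMono φ → ∀ x y z, P (φ x) (φ y) (φ z) → P x y z)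
    (hc : IsAvoidingWord P n c)
    (h1 : ∀ j k, j < n → k < n → c j < c k →
      ¬ P 1 (if c (j + 1) = 0 then 0 else c (j + 1) + 1) (if c (k + 1) = 0 then 0 else c (k + 1) + 1)) :
    IsAvoidingWord P (n + 1) (consWord n c) := by
  have hs : ∀ i, i < n → consWord n c (i + 1) = c i + 1 := by
    intro i hi; simp [consWord, show ¬ n < i + 1 by omega]
  have h0 : consWord n c 0 = 0 := by simp [consWord]
  have hss : ∀ i, i < n → consWord n c (i + 1 + 1) = if c (i + 1) = 0 then 0 else c (i + 1) + 1 := by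
    intro i hi
    by_cases hin : i + 1 < n
    · have := hc.pos (by omega) hin
      rw [hs _ hin, if_neg (by omega)]
    · rw [hc.tail (i + 1) (by omega)]
      simp [consWord]; omega
  refine ⟨⟨h0, ?_, ?_, ?_⟩, ?_, ?_⟩
  · intro i hi; simp only [consWord]; rw [if_pos (by omega)]
  · intro i hi
    rcases i with _ | i
    · omega
    · rw [hs i (by omega)]
      have := hc.lt i (by omega)
      omega
  · intro i j hi hj h
    rcases i with _ | i <;> rcases j with _ | j
    · rfl
    · rw [h0, hs j (by omega)] at h; omega
    · rw [h0, hs i (by omega)] at h; omega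
    · rw [hs i (by omega), hs j (by omega)] at h
      rw [hc.inj i j (by omega) (by omega) (by omega)]
  · intro i j k hij hjk hk
    obtain ⟨j, rfl⟩ := Nat.exists_eq_succ_of_ne_zero (show j ≠ 0 by omega)
    obtain ⟨k, rfl⟩ := Nat.exists_eq_succ_of_ne_zero (show k ≠ 0 by omega)
    rcases i with _ | i
    · rw [h0]; omega
    · simp only [Nat.succ_eq_add_one]
      rw [hs i (by omega), hs j (by omega), hs k (by omega)]
      have := hc.cyc i j k (by omega) (by omega) (by omega)
      omega
  · intro i j k hi hj hk hij hjk
    rcases j with _ | j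
    · omega
    rcases k with _ | k
    · omega
    rw [hs j (by omega), hs k (by omega)] at hjk
    rw [hss j (by omega), hss k (by omega)]
    rcases i with _ | i
    · rw [hs 0 hn, hc.zero]
      exact h1 j k (by omega) (by omega) (by omega)
    · rw [hs i (by omega), hs j (by omega)] at hij
      rw [hss i (by omega)]
      intro hp
      refine hc.oneLine i j k (by omega) (by omega) (by omega) (by omega) (by omega)
        (hP (fun x => if x = 0 then 0 else x + 1) ?_ _ _ _ hp)
      intro x y hxy
      simp only
      split_ifs <;> omega

lemma exists_consWord_eq {P : ℕ → ℕ → ℕ → Prop} {n : ℕ} {d : ℕ → ℕ} (hn : 0 < n)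
    (hP : ∀ φ : ℕ → ℕ, StrictMono φ → ∀ x y z, P x y z → P (φ x) (φ y) (φ z))
    (hd : IsAvoidingWord P (n + 1) d) (h1 : d 1 = 1) :
    ∃ c, IsAvoidingWord P n c ∧ consWord n c = d := by
  have hpos : ∀ i, i < n → 0 < d (i + 1) := fun i hi => hd.pos (by omega) (by omega)
  refine ⟨fun i => d (i + 1) - 1, ⟨⟨by simp [h1], ?_, ?_, ?_⟩, ?_, ?_⟩, ?_⟩
  · intro i hi
    rw [hd.tail _ (by omega)]
  · intro i hi
    have := hd.lt (i + 1) (by omega)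
    omega
  · intro i j hi hj h
    have := hpos i hi
    have := hpos j hj
    have := hd.inj (i + 1) (j + 1) (by omega) (by omega) (by omega)
    omega
  · intro i j k hij hjk hk
    have := hd.cyc (i + 1) (j + 1) (k + 1) (by omega) (by omega) (by omega)
    omega
  · intro i j k hi hj hk hij hjk hp
    refine hd.oneLine (i + 1) (j + 1) (k + 1) (by omega) (by omega) (by omega) (by omega)
      (by omega) ?_
    -- The subtraction d - 1 merges the letters 0 and 1, but 1 sits at index 1 and is no later
    -- letter; the value 0 arises only past the end.
    have hφ : ∀ i, i < n →
        d (i + 1 + 1) = if d (i + 1 + 1) - 1 = 0 then 0 else d (i + 1 + 1) - 1 + 1 := by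
      intro i hi
      split_ifs with h
      · by_cases hin : i + 1 < n
        · have := hpos (i + 1) hin
          have := hd.inj (i + 1 + 1) 1 (by omega) (by omega) (by omega)
          omega
        · exact hd.tail _ (by omega)
      · omega
    rw [hφ i hi, hφ j hj, hφ k hk]
    refine hP (fun x => if x = 0 then 0 else x + 1) ?_ _ _ _ hp
    intro x y hxy
    simp only
    split_ifs <;> omega
  · funext i
    unfold consWord
    split_ifs with hi
    · rcases hi with rfl | hi
      · rw [hd.zero]
      · rw [hd.tail i (by omega)]
    · have := hpos (i - 1) (by omega)
      rw [show i - 1 + 1 = i by omega] at this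
      simp only [show i - 1 + 1 = i by omega]
      omega

lemma isCycleWord_snocWord {n : ℕ} {c : ℕ → ℕ} (hn : 0 < n) (hc : IsCycleWord n c) :
    IsCycleWord (n + 1) (snocWord n c) := by
  have hs : ∀ i, 0 < i → i ≤ n → snocWord n c i = c i + 1 := by
    intro i h0 hi; simp only [snocWord]; rw [if_neg (by omega)]
  have h0 : snocWord n c 0 = 0 := by simp [snocWord]
  have hpos : ∀ i, 0 < i → i < n → 0 < c i := fun i h0 hi => hc.pos h0 hi
  have hcn := hc.apply_end
  refine ⟨h0, ?_, ?_, ?_⟩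
  · intro i hi; simp only [snocWord]; rw [if_pos (by omega)]
  · intro i hi
    rcases Nat.eq_zero_or_pos i with rfl | hi0
    · omega
    · rw [hs i hi0 (by omega)]
      rcases Nat.lt_or_ge i n with h | h
      · have := hc.lt i h
        omega
      · rw [hc.tail i h]; omega
  · intro i j hi hj h
    rcases Nat.eq_zero_or_pos i with rfl | hi0 <;> rcases Nat.eq_zero_or_pos j with rfl | hj0
    · rfl
    · rw [h0, hs j hj0 (by omega)] at h; omega
    · rw [h0, hs i hi0 (by omega)] at h; omega
    · rw [hs i hi0 (by omega), hs j hj0 (by omega)] at h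
      rcases Nat.lt_or_ge i n with hin | hin <;> rcases Nat.lt_or_ge j n with hjn | hjn
      · exact hc.inj i j hin hjn (by omega)
      · have := hpos i hi0 hin
        have := hc.tail j hjn
        omega
      · have := hpos j hj0 hjn
        have := hc.tail i hin
        omega
      · omega

lemma snocWord_cyc {n : ℕ} {c : ℕ → ℕ} (hc : IsCycleWord n c)
    (h : ∀ i j k, i < j → j < k → k < n → ¬ (c j < c k ∧ c k < c i)) :
    ∀ i j k, i < j → j < k → k < n + 1 →
      ¬ (snocWord n c j < snocWord n c k ∧ snocWord n c k < snocWord n c i) := by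
  have hs : ∀ i, 0 < i → i ≤ n → snocWord n c i = c i + 1 := by
    intro i h0 hi; simp only [snocWord]; rw [if_neg (by omega)]
  have h0 : snocWord n c 0 = 0 := by simp [snocWord]
  intro i j k hij hjk hk
  rw [hs j (by omega) (by omega), hs k (by omega) (by omega)]
  rcases Nat.eq_zero_or_pos i with rfl | hi0
  · rw [h0]; omega
  · rw [hs i hi0 (by omega)]
    rcases Nat.lt_or_ge k n with hkn | hkn
    · have := h i j k hij hjk hkn
      omega
    · rw [hc.tail k hkn]; omega

lemma snocWord_lt_iff {n : ℕ} {c : ℕ → ℕ} (hc : IsCycleWord n c) {i j : ℕ}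
    (hi : i < n) (hj : j < n) : snocWord n c i < snocWord n c j ↔ c i < c j := by
  rcases Nat.eq_zero_or_pos i with rfl | hi0 <;> rcases Nat.eq_zero_or_pos j with rfl | hj0
  · simp
  · have := hc.pos hj0 hj
    simp [snocWord, hj0.ne', hj.not_gt, hc.zero, this]
  · simp [snocWord, hc.zero]
  · simp [snocWord, hj0.ne', hj.not_gt, hi0.ne', hi.not_gt]

lemma snocWord_succ {n : ℕ} (c : ℕ → ℕ) {i : ℕ} (hi : i < n) :
    snocWord n c (i + 1) = c (i + 1) + 1 := by
  simp only [snocWord]; rw [if_neg (by omega)]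

/-- The new letter 1 maps to 0, so the one-line form gains the entry 0 in its second place and the
other entries rise by 1. Such an entry has only one entry before it and can play only the first or
second letter of a pattern. -/
lemma isAvoidingWord_snocWord {P : ℕ → ℕ → ℕ → Prop} {n : ℕ} {c : ℕ → ℕ} (hn : 0 < n)
    (hP : ∀ φ : ℕ → ℕ, StrictMono φ → ∀ x y z, P (φ x) (φ y) (φ z) → P x y z)
    (h0 : ∀ x y, ¬ P 0 x y ∧ ¬ P x 0 y)
    (hc : IsAvoidingWord P n c) : IsAvoidingWord P (n + 1) (snocWord n c) := by
  refine ⟨isCycleWord_snocWord hn hc.toIsCycleWord, snocWord_cyc hc.toIsCycleWord hc.cyc, ?_⟩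
  have hn1 : snocWord n c (n + 1) = 0 := by simp [snocWord]
  have hn0 : snocWord n c n = 1 := by simp [snocWord, hc.apply_end, hn.ne']
  intro i j k hi hj hk hij hjk
  rcases Nat.eq_or_lt_of_le (Nat.le_of_lt_succ hi) with rfl | hi
  · rw [hn1]; exact (h0 _ _).1
  rcases Nat.eq_or_lt_of_le (Nat.le_of_lt_succ hj) with rfl | hj
  · rw [hn1]; exact (h0 _ _).2
  rcases Nat.eq_or_lt_of_le (Nat.le_of_lt_succ hk) with rfl | hk
  · omega
  rw [snocWord_lt_iff hc.toIsCycleWord hi hj] at hij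
  rw [snocWord_lt_iff hc.toIsCycleWord hj hk] at hjk
  rw [snocWord_succ c hi, snocWord_succ c hj, snocWord_succ c hk]
  intro hp
  exact hc.oneLine i j k hi hj hk hij hjk (hP (· + 1) (fun _ _ h => Nat.succ_lt_succ h) _ _ _ hp)

lemma snocSnocWord_of_le {n : ℕ} (c : ℕ → ℕ) {i : ℕ} (hi : i ≤ n) :
    snocSnocWord n c i = snocWord n c i := by
  simp only [snocSnocWord]; rw [if_neg (by omega)]

/-- The one-line form gains the maximum in its second place and 0 in its last place. The hypotheses
on `P` say that neither can take part in an occurrence. -/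
lemma isAvoidingWord_snocSnocWord {P : ℕ → ℕ → ℕ → Prop} {n : ℕ} {c : ℕ → ℕ} (hn : 0 < n)
    (hP : ∀ φ : ℕ → ℕ, StrictMono φ → ∀ x y z, P (φ x) (φ y) (φ z) → P x y z)
    (h0 : ∀ x y, ¬ P x y 0) (hmax : ∀ x y z, x ≤ z → y ≤ z → ¬ P z x y ∧ ¬ P x z y)
    (hc : IsAvoidingWord P n c) : IsAvoidingWord P (n + 2) (snocSnocWord n c) := by
  have hw := isCycleWord_snocWord hn hc.toIsCycleWord
  have hle := fun i (hi : i ≤ n) => snocSnocWord_of_le c hi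
  have hn2 : snocSnocWord n c (n + 2) = 0 := by simp [snocSnocWord, snocWord]
  have hn1 : snocSnocWord n c (n + 1) = n + 1 := by simp [snocSnocWord]
  have hn0 : snocSnocWord n c n = 1 := by
    simp [snocSnocWord, snocWord, hc.apply_end, hn.ne']
  have hlt : ∀ i, i < n + 2 → snocSnocWord n c i < n + 2 := by
    intro i hi
    rcases Nat.eq_or_lt_of_le (Nat.le_of_lt_succ hi) with rfl | hi
    · omega
    · rw [hle i (by omega)]
      have := hw.lt i hi
      omega
  refine ⟨⟨?_, ?_, hlt, ?_⟩, ?_, ?_⟩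
  · rw [hle 0 (by omega), hw.zero]
  · intro i hi
    simp only [snocSnocWord, snocWord]
    rw [if_neg (by omega), if_pos (by omega)]
  · intro i j hi hj h
    rcases Nat.eq_or_lt_of_le (Nat.le_of_lt_succ hi) with rfl | hi <;>
    rcases Nat.eq_or_lt_of_le (Nat.le_of_lt_succ hj) with rfl | hj
    · rfl
    · rw [hn1, hle j (by omega)] at h
      have := hw.lt j hj
      omega
    · rw [hn1, hle i (by omega)] at h
      have := hw.lt i hi
      omega
    · rw [hle i (by omega), hle j (by omega)] at h
      exact hw.inj i j hi hj h
  · intro i j k hij hjk hk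
    rcases Nat.eq_or_lt_of_le (Nat.le_of_lt_succ hk) with rfl | hk
    · have := hlt i (by omega)
      omega
    · rw [hle i (by omega), hle j (by omega), hle k (by omega)]
      exact snocWord_cyc hc.toIsCycleWord hc.cyc i j k hij hjk hk
  · intro i j k hi hj hk hij hjk
    rcases Nat.eq_or_lt_of_le (Nat.le_of_lt_succ hk) with rfl | hk
    · rw [hn2]; exact h0 _ _
    rcases Nat.eq_or_lt_of_le (Nat.le_of_lt_succ hi) with rfl | hi
    · have := hlt j hj
      omega
    rcases Nat.eq_or_lt_of_le (Nat.le_of_lt_succ hj) with rfl | hj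
    · rw [hle k (by omega)] at hjk
      have := hw.lt k hk
      omega
    have hv : ∀ i, i < n + 1 → snocSnocWord n c (i + 1) ≤ n + 1 := by
      intro i hi
      have := hlt (i + 1) (by omega)
      omega
    rcases Nat.eq_or_lt_of_le (Nat.le_of_lt_succ hi) with rfl | hi
    · rw [hn1]; exact (hmax _ _ _ (hv _ hj) (hv _ hk)).1
    rcases Nat.eq_or_lt_of_le (Nat.le_of_lt_succ hj) with rfl | hj
    · rw [hn1]; exact (hmax _ _ _ (hv _ (by omega)) (hv _ hk)).2
    rcases Nat.eq_or_lt_of_le (Nat.le_of_lt_succ hk) with rfl | hk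
    · omega
    rw [hle i (by omega), hle j (by omega), snocWord_lt_iff hc.toIsCycleWord hi hj] at hij
    rw [hle j (by omega), hle k (by omega), snocWord_lt_iff hc.toIsCycleWord hj hk] at hjk
    rw [hle _ hi, hle _ hj, hle _ hk, snocWord_succ c hi, snocWord_succ c hj, snocWord_succ c hk]
    intro hp
    exact hc.oneLine i j k hi hj hk hij hjk
      (hP (· + 1) (fun _ _ h => Nat.succ_lt_succ h) _ _ _ hp)

/-- The word `0, d 1 - 1, …, d (n - 1) - 1` obtained from `d`. -/
def truncWord (n : ℕ) (d : ℕ → ℕ) (i : ℕ) : ℕ := if i < n then d i - 1 else 0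

/-- Cutting at the letter 1 makes its predecessor the last letter, whose successor must be 0:
lowering by one turns the removed 1 into exactly that 0. -/
lemma isAvoidingWord_truncWord {P : ℕ → ℕ → ℕ → Prop} {N n : ℕ} {d : ℕ → ℕ} (hn : 0 < n)
    (hnN : n < N) (hP : ∀ φ : ℕ → ℕ, StrictMono φ → ∀ x y z, P x y z → P (φ x) (φ y) (φ z))
    (hd : IsAvoidingWord P N d) (hdn : d n = 1) (hlt : ∀ i, i < n → d i ≤ n) :
    IsAvoidingWord P n (truncWord n d) := by
  have hpos : ∀ i, 0 < i → i < n → 1 < d i := by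
    intro i h0 hi
    have := hd.pos h0 (by omega)
    have := hd.ne (by omega : i < N) hnN (by omega)
    omega
  have ht : ∀ i, i < n → truncWord n d i = d i - 1 := fun i hi => if_pos hi
  have hts : ∀ i, i < n → d (i + 1) = truncWord n d (i + 1) + 1 := by
    intro i hi
    unfold truncWord
    split_ifs with h
    · have := hpos (i + 1) (by omega) h
      omega
    · rw [show i + 1 = n by omega, hdn]
  have hd0 := hd.zero
  refine ⟨⟨by rw [ht 0 hn, hd0], fun i hi => if_neg (by omega), ?_, ?_⟩, ?_, ?_⟩
  · intro i hi
    rw [ht i hi]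
    have := hlt i hi
    omega
  · intro i j hi hj h
    rw [ht i hi, ht j hj] at h
    rcases Nat.eq_zero_or_pos i with rfl | hi0 <;> rcases Nat.eq_zero_or_pos j with rfl | hj0
    · rfl
    · have := hpos j hj0 hj
      omega
    · have := hpos i hi0 hi
      omega
    · have := hpos j hj0 hj
      have := hpos i hi0 hi
      exact hd.inj i j (by omega) (by omega) (by omega)
  · intro i j k hij hjk hk
    rw [ht i (by omega), ht j (by omega), ht k hk]
    have := hd.cyc i j k hij hjk (by omega)
    omega
  · intro i j k hi hj hk hij hjk hp
    rw [ht i (by omega), ht j (by omega)] at hij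
    rw [ht j (by omega), ht k hk] at hjk
    refine hd.oneLine i j k (by omega) (by omega) (by omega) (by omega) (by omega) ?_
    rw [hts i hi, hts j hj, hts k hk]
    exact hP (· + 1) (fun _ _ h => Nat.succ_lt_succ h) _ _ _ hp

lemma snocWord_truncWord {N n : ℕ} {d : ℕ → ℕ} (hnN : n < N) (hd : IsCycleWord N d)
    (hdn : d n = 1) {i : ℕ} (hi : i ≤ n) : snocWord n (truncWord n d) i = d i := by
  rcases Nat.eq_zero_or_pos i with rfl | h0
  · simp [snocWord, hd.zero]
  · obtain ⟨i, rfl⟩ := Nat.exists_eq_succ_of_ne_zero h0.ne'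
    rw [Nat.succ_eq_add_one, snocWord_succ _ hi]
    unfold truncWord
    split_ifs with h
    · have := hd.pos h0 (by omega)
      simp only [Nat.succ_eq_add_one] at this
      omega
    · rw [show i + 1 = n by omega, hdn]

lemma exists_snocWord_eq {P : ℕ → ℕ → ℕ → Prop} {n : ℕ} {d : ℕ → ℕ} (hn : 0 < n)
    (hP : ∀ φ : ℕ → ℕ, StrictMono φ → ∀ x y z, P x y z → P (φ x) (φ y) (φ z))
    (hd : IsAvoidingWord P (n + 1) d) (hdn : d n = 1) :
    ∃ c, IsAvoidingWord P n c ∧ snocWord n c = d := by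
  refine ⟨truncWord n d, isAvoidingWord_truncWord hn (by omega) hP hd hdn ?_, funext fun i => ?_⟩
  · intro i hi
    have := hd.lt i (by omega)
    omega
  · rcases Nat.lt_or_ge n i with hi | hi
    · rw [hd.tail i (by omega)]
      simp [snocWord, hi]
    · exact snocWord_truncWord (by omega) hd.toIsCycleWord hdn hi

lemma exists_snocSnocWord_eq {P : ℕ → ℕ → ℕ → Prop} {n : ℕ} {d : ℕ → ℕ} (hn : 0 < n)
    (hP : ∀ φ : ℕ → ℕ, StrictMono φ → ∀ x y z, P x y z → P (φ x) (φ y) (φ z))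
    (hd : IsAvoidingWord P (n + 2) d) (hdn : d n = 1) (hdn1 : d (n + 1) = n + 1) :
    ∃ c, IsAvoidingWord P n c ∧ snocSnocWord n c = d := by
  refine ⟨truncWord n d, isAvoidingWord_truncWord hn (by omega) hP hd hdn ?_, funext fun i => ?_⟩
  · intro i hi
    have := hd.lt i (by omega)
    have := hd.ne (by omega : i < n + 2) (by omega : n + 1 < n + 2) (by omega)
    omega
  · rcases Nat.lt_or_ge n i with hi | hi
    · rcases Nat.lt_or_ge (n + 1) i with hi1 | hi1
      · rw [hd.tail i (by omega)]
        simp [snocSnocWord, snocWord, hi, hi1.ne']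
      · rw [show i = n + 1 by omega, hdn1]
        simp [snocSnocWord]
    · rw [snocSnocWord_of_le _ hi]
      exact snocWord_truncWord (by omega) hd.toIsCycleWord hdn hi

/-! ### Lengths one and two -/

lemma setOf_isAvoidingWord_one (P : ℕ → ℕ → ℕ → Prop) :
    {c | IsAvoidingWord P 1 c} = {fun _ => 0} := by
  ext c
  constructor
  · intro h
    funext i
    rcases Nat.eq_zero_or_pos i with rfl | hi
    · exact h.zero
    · exact h.tail i hi
  · rintro rfl
    exact ⟨⟨rfl, fun _ _ => rfl, fun i hi => by omega, fun i j _ _ _ => by omega⟩,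
      fun i j k _ _ _ => by omega, fun i j k _ _ _ h => by omega⟩

lemma setOf_isAvoidingWord_two (P : ℕ → ℕ → ℕ → Prop) :
    {c | IsAvoidingWord P 2 c} = {decWord 2} := by
  ext c
  constructor
  · intro h
    have h1 := h.pos (i := 1) (by omega) (by omega)
    have h2 := h.lt 1 (by omega)
    exact h.eq_decWord le_rfl (by omega)
  · rintro rfl
    refine ⟨⟨rfl, ?_, ?_, ?_⟩, ?_, ?_⟩
    · intro i hi; unfold decWord; split_ifs <;> omega
    · intro i hi; unfold decWord; split_ifs <;> omega
    · intro i j hi hj; unfold decWord; split_ifs <;> omega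
    · intro i j k; omega
    · intro i j k hi hj hk; unfold decWord; split_ifs <;> omega

/-! ### One-line pattern 231 -/

section Pattern231

lemma IsAvoidingWord.apply_one_of_231 {n : ℕ} {c : ℕ → ℕ} (h : IsAvoidingWord Ord231 n c)
    (hn : 2 ≤ n) : c 1 = n - 1 := by
  obtain ⟨j, hj, hcj⟩ := h.exists_succ_eq (x := n - 1) (by omega) (by omega)
  by_contra hne
  have hj0 : j ≠ 0 := by rintro rfl; exact hne hcj
  have hp := h.pos (by omega : 0 < j) (by omega)
  have hpn := h.lt j (by omega)
  obtain ⟨y, hjy, hyn, hy, hy1⟩ := exists_crossing (fun i => c j ≤ c i) (a := j + 1) (b := n)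
    (by omega) (by omega) (by simp only [h.apply_end]; omega)
  simp only [not_le] at hy hy1
  have hyj := h.ne hyn (by omega : j < n) (by omega)
  -- If c i < c j < c y, the images c (i + 1), n - 1, c (y + 1) must not form a 231, so c (i + 1)
  -- stays below c j too. Hence the walk from 0 can never reach c j.
  have key : ∀ i, i ≤ j → c i < c j := by
    intro i
    induction i with
    | zero => intro _; rw [h.zero]; exact hp
    | succ i ih =>
      intro hij
      have hi := ih (by omega)
      have h1 := h.oneLine i j y (by omega) (by omega) hyn hi (by omega)
      have h2 := h.lt (i + 1) (by omega)
      have h3 := h.ne (by omega : i + 1 < n) hj (by omega)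
      simp only [Ord231] at h1
      omega
  exact lt_irrefl _ (key j le_rfl)

lemma setOf_isAvoidingWord_231 {n : ℕ} (hn : 2 ≤ n) :
    {c | IsAvoidingWord Ord231 n c} = {decWord n} := by
  ext c
  constructor
  · intro h
    exact h.eq_decWord hn (IsAvoidingWord.apply_one_of_231 h hn)
  · rintro rfl
    exact isAvoidingWord_decWord fun x y z hxy hyz => by simp only [Ord231]; omega

end Pattern231

/-! ### One-line pattern 321 -/

section Pattern321

/-- Otherwise let x be the letter before 1 and z the last letter. Avoiding 312 gives x < z, and the
images of 0 < x < z are c 1 > 1 > 0, a 321. -/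
lemma IsAvoidingWord.apply_one_or_of_321 {n : ℕ} {c : ℕ → ℕ}
    (h : IsAvoidingWord Ord321 (n + 1) c) (hn : 2 ≤ n) : c 1 = 1 ∨ c n = 1 := by
  by_contra! hne
  obtain ⟨t, ht, hct⟩ := h.exists_succ_eq (x := 1) (by omega) (by omega)
  have ht0 : t ≠ 0 := by rintro rfl; exact hne.1 hct
  have htn : t + 1 ≠ n := by rintro rfl; exact hne.2 hct
  have h1 := h.apply_one_lt_of_lt hct (by omega : t + 1 < n) (by omega)
  have h2 := h.pos (by omega : 0 < 1) (by omega)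
  have h3 := h.pos (by omega : 0 < t) (by omega)
  have h4 := h.cyc t (t + 1) n (by omega) (by omega) (by omega)
  have h5 := h.ne (by omega : t < n + 1) (by omega : n < n + 1) (by omega)
  have h6 := h.oneLine 0 t n (by omega) (by omega) (by omega) (by rw [h.zero]; exact h3) (by omega)
  have h7 := h.apply_end
  simp only [Ord321, zero_add] at h6
  omega

lemma setOf_isAvoidingWord_321_succ {n : ℕ} (hn : 2 ≤ n) :
    {c | IsAvoidingWord Ord321 (n + 1) c} =
      consWord n '' {c | IsAvoidingWord Ord321 n c} ∪
        snocWord n '' {c | IsAvoidingWord Ord321 n c} := by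
  ext c
  constructor
  · intro h
    rcases IsAvoidingWord.apply_one_or_of_321 h hn with h1 | h1
    · exact Or.inl (exists_consWord_eq (by omega) (fun φ hφ x y z => by
        simp only [Ord321, hφ.lt_iff_lt]; exact id) h h1)
    · exact Or.inr (exists_snocWord_eq (by omega) (fun φ hφ x y z => by
        simp only [Ord321, hφ.lt_iff_lt]; exact id) h h1)
  · rintro (⟨c, hc, rfl⟩ | ⟨c, hc, rfl⟩)
    · refine isAvoidingWord_consWord (by omega) (fun φ hφ x y z => by
        simp only [Ord321, hφ.lt_iff_lt]; exact id) hc ?_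
      intro j k _ _ _
      simp only [Ord321]
      split_ifs <;> omega
    · exact isAvoidingWord_snocWord (by omega) (fun φ hφ x y z => by
        simp only [Ord321, hφ.lt_iff_lt]; exact id) (by intro x y; omega) hc

lemma ncard_setOf_isAvoidingWord_321 {n : ℕ} (hn : 2 ≤ n) :
    {c | IsAvoidingWord Ord321 n c}.ncard = 2 ^ (n - 2) := by
  induction n, hn using Nat.le_induction with
  | base => simp [setOf_isAvoidingWord_two]
  | succ n hn ih =>
    have hfin := finite_setOf_isAvoidingWord Ord321 n
    have hsub : {c | IsAvoidingWord Ord321 n c} ⊆ {c | IsCycleWord n c} :=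
      fun _ h => h.toIsCycleWord
    rw [setOf_isAvoidingWord_321_succ hn, Set.ncard_union_eq ?_ (hfin.image _) (hfin.image _),
      ((consWord_injOn n).mono hsub).ncard_image, ((snocWord_injOn n).mono hsub).ncard_image, ih,
      show n + 1 - 2 = n - 2 + 1 by omega]
    · ring
    · rw [Set.disjoint_left]
      rintro _ ⟨c, hc, rfl⟩ ⟨d, hd, h⟩
      have h1 := congrFun h 1
      have h2 := IsCycleWord.pos (IsAvoidingWord.toIsCycleWord hd) (by omega : 0 < 1) (by omega)
      have h3 := IsCycleWord.zero (IsAvoidingWord.toIsCycleWord hc)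
      simp [consWord, snocWord, show ¬ n < 1 by omega, h3] at h1
      omega

end Pattern321

/-! ### One-line pattern 213 -/

section Pattern213

/-- Let m be the last letter and v the successor of n - 1. Avoiding 312 gives m ≤ v, and the images
c 1, 0, v of 0, m, n - 1 give v < c 1. A last letter below c 1 can only be 1; then 0, 1 and the
predecessor of n - 1 have images c 1, 0, n - 1, a 213. -/
lemma IsAvoidingWord.apply_last_of_213 {n : ℕ} {c : ℕ → ℕ} (h : IsAvoidingWord Ord213 n c)
    (hn : 2 ≤ n) (h1 : c 1 ≠ n - 1) : c (n - 1) = n - 1 := by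
  by_contra hm
  have hm0 := h.pos (by omega : 0 < n - 1) (by omega)
  have hmn := h.lt (n - 1) (by omega)
  have hkn := h.lt 1 (by omega)
  have hk0 := h.pos (by omega : 0 < 1) (by omega)
  obtain ⟨i, hi, hci⟩ := h.exists_eq (x := n - 1) (by omega)
  have hi1 : i < n - 1 := by
    rcases Nat.lt_or_ge i (n - 1) with h | h
    · exact h
    · rw [show i = n - 1 by omega] at hci; omega
  have hend : c (n - 1 + 1) = 0 := h.tail _ (by omega)
  have hv0 := h.pos (by omega : 0 < i + 1) (by omega)
  have hv : c (n - 1) ≤ c (i + 1) := by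
    rcases Nat.eq_or_lt_of_le (Nat.succ_le_of_lt hi1) with e | hlt
    · rw [← e]
    · have := h.cyc i (i + 1) (n - 1) (by omega) hlt (by omega)
      have := h.ne (by omega : i + 1 < n) (by omega : n - 1 < n) (by omega)
      omega
  have hz := h.zero
  have hvk := h.oneLine 0 (n - 1) i (by omega) (by omega) (by omega) (by omega) (by omega)
  simp only [Ord213, zero_add] at hvk
  have hi0 : i ≠ 0 := by rintro rfl; omega
  have hne := h.ne (by omega : 1 < n) (by omega : i + 1 < n) (by omega)
  have hm1 : c (n - 1) = 1 := by
    by_contra hne1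
    obtain ⟨t, ht, hct⟩ := h.exists_eq (x := 1) (by omega)
    have : t ≠ n - 1 := by rintro rfl; omega
    have := h.apply_one_lt_of_lt hct (by omega : t < n - 1) (by omega)
    omega
  obtain ⟨p, hp, hcp⟩ := h.exists_succ_eq (x := n - 1) (by omega) (by omega)
  have hp0 : p ≠ 0 := by rintro rfl; exact h1 hcp
  have hp1 := h.ne (by omega : p < n) (by omega : n - 1 < n) (by omega)
  have hpp := h.pos (by omega : 0 < p) (by omega)
  have := h.oneLine 0 (n - 1) p (by omega) (by omega) (by omega) (by omega) (by omega)
  simp only [Ord213, zero_add] at this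
  omega

/-- If two letters or more follow 1, let x precede 1 and y follow it. Then x < y by 312-avoidance,
and 0, x, y have images c 1, 1 and a letter above c 1, a 213. -/
lemma IsAvoidingWord.apply_penultimate_of_213 {n : ℕ} {c : ℕ → ℕ}
    (h : IsAvoidingWord Ord213 (n + 2) c) (hlast : c (n + 1) = n + 1) (h1 : c 1 ≠ 1) :
    c n = 1 := by
  have hn : n ≠ 0 := by rintro rfl; exact h1 hlast
  obtain ⟨t, ht, hct⟩ := h.exists_succ_eq (x := 1) (by omega) (by omega)
  have ht0 : t ≠ 0 := by rintro rfl; exact h1 hct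
  have htn : t ≠ n := by rintro rfl; omega
  by_contra hne
  have htn' : t + 1 ≠ n := by rintro rfl; exact hne hct
  have hk := h.pos (by omega : 0 < 1) (by omega)
  have hl := h.apply_one_lt_of_lt hct (by omega : t + 1 < t + 2) (by omega)
  have hl' := h.apply_one_lt_of_lt hct (by omega : t + 1 < t + 2 + 1) (by omega)
  have hq := h.pos (by omega : 0 < t) (by omega)
  have hc := h.cyc t (t + 1) (t + 2) (by omega) (by omega) (by omega)
  have hne' := h.ne (by omega : t < n + 2) (by omega : t + 2 < n + 2) (by omega)
  have hz := h.zero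
  have ho := h.oneLine 0 t (t + 2) (by omega) (by omega) (by omega) (by omega) (by omega)
  simp only [Ord213, zero_add] at ho
  omega

lemma setOf_isAvoidingWord_213 {n : ℕ} (hn : 3 ≤ n) :
    {c | IsAvoidingWord Ord213 n c} =
      insert (decWord n) {c | IsAvoidingWord Ord213 n c ∧ c (n - 1) = n - 1} := by
  ext c
  constructor
  · intro h
    by_cases h1 : c 1 = n - 1
    · exact Or.inl (IsAvoidingWord.eq_decWord h (by omega) h1)
    · exact Or.inr ⟨h, IsAvoidingWord.apply_last_of_213 h (by omega) h1⟩
  · rintro (rfl | h)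
    · exact isAvoidingWord_decWord fun x y z hxy hyz => by simp only [Ord213]; omega
    · exact h.1

lemma setOf_isAvoidingWord_213_last {n : ℕ} (hn : 2 ≤ n) :
    {c | IsAvoidingWord Ord213 (n + 2) c ∧ c (n + 1) = n + 1} =
      consWord (n + 1) '' {c | IsAvoidingWord Ord213 (n + 1) c ∧ c n = n} ∪
        snocSnocWord n '' {c | IsAvoidingWord Ord213 n c} := by
  ext c
  constructor
  · rintro ⟨h, hl⟩
    by_cases h1 : c 1 = 1
    · obtain ⟨d, hd, rfl⟩ := exists_consWord_eq (by omega) (fun φ hφ x y z => by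
        simp only [Ord213, hφ.lt_iff_lt]; exact id) h h1
      refine Or.inl ⟨d, ⟨hd, ?_⟩, rfl⟩
      simpa [consWord] using hl
    · exact Or.inr (exists_snocSnocWord_eq (by omega) (fun φ hφ x y z => by
        simp only [Ord213, hφ.lt_iff_lt]; exact id) h
        (IsAvoidingWord.apply_penultimate_of_213 h hl h1) hl)
  · rintro (⟨c, ⟨hc, hl⟩, rfl⟩ | ⟨c, hc, rfl⟩)
    · refine ⟨isAvoidingWord_consWord (by omega) (fun φ hφ x y z => by
        simp only [Ord213, hφ.lt_iff_lt]; exact id) hc ?_, ?_⟩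
      · intro j k hj hk hjk
        -- With the new entry 1 as its first letter, a 213 needs the entry 0 in the middle. That
        -- entry stands at the largest letter, and nothing lies to its right.
        have : j ≠ n := by
          rintro rfl
          have := hc.lt k hk
          omega
        have := hc.pos (by omega : 0 < j + 1) (by omega)
        simp only [Ord213]
        split_ifs <;> omega
      · simp [consWord, hl]
    · exact ⟨isAvoidingWord_snocSnocWord (by omega) (fun φ hφ x y z => by
        simp only [Ord213, hφ.lt_iff_lt]; exact id) (by intro x y; omega)
        (by intro x y z; omega) hc, by simp [snocSnocWord]⟩

lemma ncard_setOf_isAvoidingWord_213_last {n : ℕ} (hn : 3 ≤ n) :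
    {c | IsAvoidingWord Ord213 n c}.ncard =
      {c | IsAvoidingWord Ord213 n c ∧ c (n - 1) = n - 1}.ncard + 1 := by
  conv_lhs => rw [setOf_isAvoidingWord_213 hn]
  rw [Set.ncard_insert_of_notMem ?_
    ((finite_setOf_isAvoidingWord Ord213 n).subset fun _ h => h.1)]
  rintro ⟨-, h⟩
  simp only [decWord] at h
  rw [if_neg (by omega)] at h
  omega

/-- Each total exceeds by one, for the decreasing word, the number of words ending in their largest
letter; these extra ones cancel. -/
lemma ncard_setOf_isAvoidingWord_213_add_two {n : ℕ} (hn : 2 ≤ n) :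
    {c | IsAvoidingWord Ord213 (n + 2) c}.ncard =
      {c | IsAvoidingWord Ord213 n c}.ncard + {c | IsAvoidingWord Ord213 (n + 1) c}.ncard := by
  rw [ncard_setOf_isAvoidingWord_213_last (by omega : 3 ≤ n + 2),
    ncard_setOf_isAvoidingWord_213_last (by omega : 3 ≤ n + 1)]
  have hfin := finite_setOf_isAvoidingWord Ord213 n
  have hfin' : {c | IsAvoidingWord Ord213 (n + 1) c ∧ c n = n}.Finite :=
    (finite_setOf_isAvoidingWord Ord213 (n + 1)).subset fun _ h => h.1
  simp only [show n + 2 - 1 = n + 1 by omega, show n + 1 - 1 = n by omega]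
  rw [setOf_isAvoidingWord_213_last hn, Set.ncard_union_eq ?_ (hfin'.image _) (hfin.image _),
    ((consWord_injOn _).mono ?_).ncard_image, ((snocSnocWord_injOn n).mono ?_).ncard_image]
  · omega
  · exact fun _ h => h.toIsCycleWord
  · exact fun _ h => h.1.toIsCycleWord
  · rw [Set.disjoint_left]
    rintro _ ⟨c, hc, rfl⟩ ⟨d, hd, h⟩
    have h1 := congrFun h 1
    have h2 := IsCycleWord.pos (IsAvoidingWord.toIsCycleWord hd) (by omega : 0 < 1) (by omega)
    have h3 := hc.1.zero
    simp [consWord, snocSnocWord, snocWord, show ¬ n < 1 by omega, show n ≠ 0 by omega, h3] at h1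
    omega

lemma ncard_setOf_isAvoidingWord_213_three :
    {c | IsAvoidingWord Ord213 3 c}.ncard = 2 := by
  rw [ncard_setOf_isAvoidingWord_213_last le_rfl]
  have : {c | IsAvoidingWord Ord213 3 c ∧ c (3 - 1) = 3 - 1} =
      {snocSnocWord 1 (fun _ => 0)} := by
    ext c
    constructor
    · rintro ⟨h, hl⟩
      have hl' : c 2 = 2 := hl
      have h1 : c 1 = 1 := by
        have := h.lt 1 (by omega)
        have := h.pos (by omega : 0 < 1) (by omega)
        have := h.ne (by omega : 1 < 3) (by omega : 2 < 3) (by omega)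
        omega
      obtain ⟨d, hd, rfl⟩ := exists_snocSnocWord_eq (n := 1) (by omega) (fun φ hφ x y z => by
        simp only [Ord213, hφ.lt_iff_lt]; exact id) h h1 hl'
      have hd' : d ∈ {c | IsAvoidingWord Ord213 1 c} := hd
      rw [setOf_isAvoidingWord_one] at hd'
      rw [hd']; rfl
    · rintro rfl
      refine ⟨isAvoidingWord_snocSnocWord (by omega) (fun φ hφ x y z => by
        simp only [Ord213, hφ.lt_iff_lt]; exact id) (by intro x y; omega)
        (by intro x y z; omega) ?_, by simp [snocSnocWord]⟩
      have : (fun _ => 0) ∈ {c | IsAvoidingWord Ord213 1 c} := by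
        rw [setOf_isAvoidingWord_one]; rfl
      exact this
  rw [this, Set.ncard_singleton]

lemma ncard_setOf_isAvoidingWord_213 (n : ℕ) :
    {c | IsAvoidingWord Ord213 (n + 2) c}.ncard = Nat.fib (n + 2) := by
  induction n using Nat.twoStepInduction with
  | zero => simp [setOf_isAvoidingWord_two]
  | one => rw [ncard_setOf_isAvoidingWord_213_three]; rfl
  | more n ih1 ih2 =>
    rw [ncard_setOf_isAvoidingWord_213_add_two (by omega), ih1, ih2, Nat.fib_add_two (n := n + 2)]

end Pattern213

/-! ### One-line pattern 132 -/

section Pattern132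

/-- The word `0, k, k - 1, …, 1, k + 1, k + 2, …, n - 1`. -/
def stairWord (n k i : ℕ) : ℕ :=
  if i = 0 ∨ n ≤ i then 0 else if i ≤ k then k + 1 - i else i

lemma isAvoidingWord_stairWord {n k : ℕ} (hk : 1 ≤ k) (hkn : k < n) :
    IsAvoidingWord Ord132 n (stairWord n k) := by
  have h0 : stairWord n k 0 = 0 := by simp [stairWord]
  have hle : ∀ i, 1 ≤ i → i ≤ k → stairWord n k i = k + 1 - i := by
    intro i h1 h2; simp only [stairWord]; rw [if_neg (by omega), if_pos h2]
  have hgt : ∀ i, k < i → i < n → stairWord n k i = i := by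
    intro i h1 h2; simp only [stairWord]; rw [if_neg (by omega), if_neg (by omega)]
  have hn : ∀ i, n ≤ i → stairWord n k i = 0 := by
    intro i h; simp only [stairWord]; rw [if_pos (by omega)]
  -- Every letter with its image. If k + 1 < n the one-line form is k, k + 1, 1, …, k - 1, k + 2, …,
  -- n - 1, 0.
  have cases : ∀ i, i < n → (i = 0 ∧ stairWord n k i = 0 ∧ stairWord n k (i + 1) = k) ∨
      (1 ≤ i ∧ i < k ∧ stairWord n k i = k + 1 - i ∧ stairWord n k (i + 1) = k - i) ∨
      (i = k ∧ stairWord n k i = 1 ∧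
        (k + 1 < n ∧ stairWord n k (i + 1) = k + 1 ∨ k + 1 = n ∧ stairWord n k (i + 1) = 0)) ∨
      (k < i ∧ i + 1 < n ∧ stairWord n k i = i ∧ stairWord n k (i + 1) = i + 1) ∨
      (k < i ∧ i + 1 = n ∧ stairWord n k i = i ∧ stairWord n k (i + 1) = 0) := by
    intro i hi
    rcases Nat.eq_zero_or_pos i with rfl | hi0
    · left
      rw [h0, hle 1 le_rfl hk]
      omega
    right
    rcases Nat.lt_trichotomy i k with h | rfl | h
    · left
      rw [hle i hi0 h.le, hle (i + 1) (by omega) h]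
      omega
    · right; left
      rw [hle i hi0 le_rfl]
      refine ⟨rfl, by omega, ?_⟩
      rcases Nat.eq_or_lt_of_le (Nat.succ_le_of_lt hi) with e | h
      · exact Or.inr ⟨e, hn _ e.ge⟩
      · exact Or.inl ⟨h, hgt _ (by omega) h⟩
    · right; right
      rw [hgt i h hi]
      rcases Nat.eq_or_lt_of_le (Nat.succ_le_of_lt hi) with e | h1
      · exact Or.inr ⟨h, e, rfl, hn _ e.ge⟩
      · exact Or.inl ⟨h, h1, rfl, hgt _ (by omega) h1⟩
  refine ⟨⟨h0, hn, ?_, ?_⟩, ?_, ?_⟩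
  · intro i hi
    have := cases i hi
    omega
  · intro i j hi hj h
    have := cases i hi
    have := cases j hj
    omega
  · intro i j l hij hjl hl
    have := cases i (by omega)
    have := cases j (by omega)
    have := cases l (by omega)
    omega
  · intro i j l hi hj hl hij hjl
    simp only [Ord132]
    have := cases i hi
    rcases cases j hj with h | h | h | h | h <;> rcases cases l hl with h' | h' | h' | h' | h' <;>
      omega

/-- Let x be the predecessor and v the successor of n - 1, and m the last letter. From the images c
1, n - 1, v of 0, x, n - 1 follows v < c 1, so m ≤ v < c 1 and m = 1. Then 1, x, n - 1 have images
0, n - 1, v, a 132. -/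
lemma IsAvoidingWord.apply_last_of_132 {n : ℕ} {c : ℕ → ℕ} (h : IsAvoidingWord Ord132 n c)
    (hn : 2 ≤ n) (h1 : c 1 ≠ n - 1) : c (n - 1) = n - 1 := by
  by_contra hm
  have hm0 := h.pos (by omega : 0 < n - 1) (by omega)
  have hmn := h.lt (n - 1) (by omega)
  have hkn := h.lt 1 (by omega)
  have hk0 := h.pos (by omega : 0 < 1) (by omega)
  obtain ⟨i, hi, hci⟩ := h.exists_eq (x := n - 1) (by omega)
  have hi1 : i < n - 1 := by
    rcases Nat.lt_or_ge i (n - 1) with h | h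
    · exact h
    · rw [show i = n - 1 by omega] at hci; omega
  have hend : c (n - 1 + 1) = 0 := h.tail _ (by omega)
  have hv0 := h.pos (by omega : 0 < i + 1) (by omega)
  have hvn := h.lt (i + 1) (by omega)
  have hv1 := h.ne (by omega : i + 1 < n) (by omega : i < n) (by omega)
  have hz := h.zero
  have hi0 : i ≠ 0 := by rintro rfl; omega
  have hne := h.ne (by omega : 1 < n) (by omega : i + 1 < n) (by omega)
  obtain ⟨p, hp, hcp⟩ := h.exists_succ_eq (x := n - 1) (by omega) (by omega)
  have hp0 : p ≠ 0 := by rintro rfl; exact h1 hcp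
  have hpp := h.pos (by omega : 0 < p) (by omega)
  have hpi := h.ne (by omega : p < n) (by omega : i < n) (by rintro rfl; omega)
  have hpn := h.lt p (by omega)
  have hvk := h.oneLine 0 p i (by omega) (by omega) (by omega) (by omega) (by omega)
  simp only [Ord132, zero_add] at hvk
  have hv : c (n - 1) ≤ c (i + 1) := by
    rcases Nat.eq_or_lt_of_le (Nat.succ_le_of_lt hi1) with e | hlt
    · rw [← e]
    · have := h.cyc i (i + 1) (n - 1) (by omega) hlt (by omega)
      have := h.ne (by omega : i + 1 < n) (by omega : n - 1 < n) (by omega)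
      omega
  have hm1 : c (n - 1) = 1 := by
    by_contra hne1
    obtain ⟨t, ht, hct⟩ := h.exists_eq (x := 1) (by omega)
    have : t ≠ n - 1 := by rintro rfl; omega
    have := h.apply_one_lt_of_lt hct (by omega : t < n - 1) (by omega)
    omega
  have hp1 := h.ne (by omega : p < n) (by omega : n - 1 < n) (by omega)
  have := h.oneLine (n - 1) p i (by omega) (by omega) (by omega) (by omega) (by omega)
  simp only [Ord132] at this
  omega

lemma IsAvoidingWord.eq_stairWord {n : ℕ} {c : ℕ → ℕ} (h : IsAvoidingWord Ord132 n c)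
    (hn : 2 ≤ n) : c = stairWord n (c 1) := by
  by_cases h1 : c 1 = n - 1
  · rw [h1]
    conv_lhs => rw [h.eq_decWord hn h1]
    funext i
    simp only [decWord, stairWord]
    split_ifs <;> omega
  have hlast := h.apply_last_of_132 hn h1
  have hkn := h.lt 1 (by omega)
  have hk0 := h.pos (by omega : 0 < 1) (by omega)
  have hz := h.zero
  obtain ⟨t, ht, hct⟩ := h.exists_eq (x := 1) (by omega)
  have ht0 : 0 < t := by
    rcases Nat.eq_zero_or_pos t with rfl | h0
    · omega
    · exact h0
  have htn : t ≠ n - 1 := by rintro rfl; omega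
  have hbig : ∀ i, t < i → i < n → c 1 < c i := fun i => h.apply_one_lt_of_lt hct
  have hb := hbig (t + 1) (by omega) (by omega)
  -- Otherwise 0, 1 and the predecessor of c 1 + 1 have images c 1, c (t + 1), c 1 + 1, a 132.
  have hb1 : c (t + 1) = c 1 + 1 := by
    obtain ⟨z, hz', hcz⟩ := h.exists_succ_eq (x := c 1 + 1) (by omega) (by omega)
    by_contra hne
    have hz0 : z ≠ 0 := by rintro rfl; simp at hcz
    have hzt : z ≠ t := by rintro rfl; exact hne hcz
    have := h.pos (by omega : 0 < z) (by omega)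
    have := h.ne (by omega : z < n) (by omega : t < n) hzt
    have := h.oneLine 0 t z (by omega) (by omega) (by omega) (by omega) (by omega)
    simp only [Ord132, zero_add] at this
    omega
  have hsmall : ∀ i, i ≤ t → c i ≤ c 1 := by
    intro i hi
    rcases Nat.eq_or_lt_of_le hi with rfl | hi
    · omega
    · have := h.cyc i t (t + 1) hi (by omega) (by omega)
      have := h.ne (by omega : i < n) (by omega : t + 1 < n) (by omega)
      omega
  have hdec : ∀ i j, 0 < i → i < j → j ≤ t → c j < c i := by
    intro i j hi hij hj
    have := hsmall j hj
    have := h.ne (by omega : 1 < n) (by omega : j < n) (by omega)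
    exact h.lt_of_lt_apply_one hi hij (by omega) (by omega)
  have hleft : ∀ i, 1 ≤ i → i ≤ t → c i = c 1 + 1 - i := by
    intro i hi
    induction i, hi using Nat.le_induction with
    | base => intro _; omega
    | succ i hi ih =>
      intro hit
      have ih := ih (by omega)
      have h2 := hdec i (i + 1) hi (by omega) hit
      have h3 := h.pos (by omega : 0 < i + 1) (by omega)
      obtain ⟨j, hj, hcj⟩ := h.exists_eq (x := c i - 1) (by have := h.lt i (by omega); omega)
      by_contra hne
      have hjt : j ≤ t := by
        by_contra hjt
        have := hbig j (by omega) hj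
        omega
      have hj0 : j ≠ 0 := by rintro rfl; omega
      have hji : i < j := by
        by_contra hji
        rcases Nat.eq_or_lt_of_le (Nat.le_of_not_lt hji) with rfl | hlt
        · omega
        · have := hdec j i (by omega) hlt (by omega)
          omega
      have hji1 : j ≠ i + 1 := by rintro rfl; omega
      have := hdec (i + 1) j (by omega) (by omega) hjt
      omega
  have htk : t = c 1 := by
    have := hleft t ht0 le_rfl
    omega
  -- If the least unused letter i did not come next, its predecessor c j would exceed c (t + m), and
  -- 0, c (t + m), c j would have images c 1, c (t + m + 1), i, a 132.
  have hright : ∀ m, ∀ i, t < i → i ≤ t + m → i < n → c i = i := by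
    intro m
    induction m with
    | zero => intro i _ _; omega
    | succ m ih =>
      intro i hi him hin
      rcases Nat.lt_or_ge i (t + m + 1) with hlt | hge
      · exact ih i hi (by omega) hin
      have e : i = t + m + 1 := by omega
      rcases Nat.eq_zero_or_pos m with rfl | hm
      · rw [e, Nat.add_zero, hb1, htk]
      have hpre := ih (t + m) (by omega) le_rfl (by omega)
      obtain ⟨j, hj, hcj⟩ := h.exists_succ_eq (x := i) (by omega) hin
      have hjt : t < j + 1 := by
        by_contra hjt
        have := hsmall (j + 1) (by omega)
        omega
      have hjm : t + m < j + 1 := by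
        by_contra hjm
        have := ih (j + 1) hjt (by omega) hj
        omega
      rcases Nat.eq_or_lt_of_le (Nat.le_of_lt_succ hjm) with rfl | hlt
      · rw [e]; exact hcj.trans e
      have hcjm : c (t + m) < c j := by
        by_contra hcon
        have h3 := hbig j (by omega) (by omega)
        have h4 := h.ne (by omega : t + m < n) (by omega : j < n) (by omega)
        have := ih (c j) (by omega) (by omega) (by omega)
        have := h.inj (c j) j (by omega) (by omega) this
        omega
      have h5 := hbig (t + m + 1) (by omega) (by omega)
      have h6 := h.ne (by omega : t + m + 1 < n) (by omega : j + 1 < n) (by omega)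
      have h7 := h.oneLine 0 (t + m) j (by omega) (by omega) (by omega) (by omega) hcjm
      simp only [Ord132, zero_add] at h7
      have := ih (c (t + m + 1)) (by omega) (by omega) (by omega)
      have := h.inj (c (t + m + 1)) (t + m + 1) (by omega) (by omega) this
      omega
  funext i
  simp only [stairWord]
  split_ifs with hi hi'
  · rcases hi with rfl | hi
    · exact hz
    · exact h.tail i hi
  · exact hleft i (by omega) (by omega)
  · exact hright i i (by omega) (by omega) (by omega)

lemma ncard_setOf_isAvoidingWord_132 {n : ℕ} (hn : 2 ≤ n) :
    {c | IsAvoidingWord Ord132 n c}.ncard = n - 1 := by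
  have : {c | IsAvoidingWord Ord132 n c} = stairWord n '' (Finset.Icc 1 (n - 1) : Finset ℕ) := by
    ext c
    constructor
    · intro h
      have h1 := IsCycleWord.pos (IsAvoidingWord.toIsCycleWord h) (by omega : 0 < 1) (by omega)
      have h2 := IsCycleWord.lt (IsAvoidingWord.toIsCycleWord h) 1 (by omega)
      exact ⟨c 1, by simp; omega, (IsAvoidingWord.eq_stairWord h hn).symm⟩
    · rintro ⟨k, hk, rfl⟩
      simp only [Finset.coe_Icc, Set.mem_Icc] at hk
      exact isAvoidingWord_stairWord hk.1 (by omega)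
  rw [this, Set.InjOn.ncard_image, Set.ncard_coe_finset, Nat.card_Icc]
  · omega
  · intro k hk l hl hkl
    simp only [Finset.coe_Icc, Set.mem_Icc] at hk hl
    have := congrFun hkl 1
    simpa [stairWord, hk.1, hl.1, show ¬ n ≤ 1 by omega] using this

end Pattern132

/-! ### The zigzag word -/

/-- The word `0, k, …, r - 2, 2, r - 1, 1` of length `r`: backwards from its end it lists
`1, r - 1, 2, r - 2, …`. -/
def zigWord (r i : ℕ) : ℕ :=
  if i = 0 then 0 else if (r - 1 - i) % 2 = 0 then 1 + (r - 1 - i) / 2 else r - 1 - (r - 1 - i) / 2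

lemma zigWord_even {r i : ℕ} (hi : 0 < i) (h : (r - 1 - i) % 2 = 0) :
    zigWord r i = 1 + (r - 1 - i) / 2 := by
  rw [zigWord, if_neg (by omega), if_pos h]

lemma zigWord_odd {r i : ℕ} (hi : 0 < i) (h : (r - 1 - i) % 2 = 1) :
    zigWord r i = r - 1 - (r - 1 - i) / 2 := by
  rw [zigWord, if_neg (by omega), if_neg (by omega)]

lemma zigWord_zero (r : ℕ) : zigWord r 0 = 0 := rfl

lemma zigWord_last {r : ℕ} (hr : 2 ≤ r) : zigWord r (r - 1) = 1 := by
  rw [zigWord_even (by omega) (by omega)]; omega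

lemma zigWord_pos {r i : ℕ} (hi : 0 < i) (hir : i < r) : 0 < zigWord r i := by
  rcases Nat.mod_two_eq_zero_or_one (r - 1 - i) with h | h
  · rw [zigWord_even hi h]; omega
  · rw [zigWord_odd hi h]; omega

lemma zigWord_lt {r i : ℕ} (hir : i < r) : zigWord r i < r := by
  rcases Nat.eq_zero_or_pos i with rfl | hi
  · exact hir
  rcases Nat.mod_two_eq_zero_or_one (r - 1 - i) with h | h
  · rw [zigWord_even hi h]; omega
  · rw [zigWord_odd hi h]; omega

lemma zigWord_of_even {r i j : ℕ} (hi : 0 < i) (hij : i < j) (hj : j < r)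
    (h : (r - 1 - j) % 2 = 0) : zigWord r j < zigWord r i := by
  rw [zigWord_even (by omega) h]
  rcases Nat.mod_two_eq_zero_or_one (r - 1 - i) with h | h
  · rw [zigWord_even hi h]; omega
  · rw [zigWord_odd hi h]; omega

lemma zigWord_of_odd {r i j : ℕ} (hi : 0 < i) (hij : i < j) (hj : j < r)
    (h : (r - 1 - j) % 2 = 1) : zigWord r i < zigWord r j := by
  rw [zigWord_odd (by omega) h]
  rcases Nat.mod_two_eq_zero_or_one (r - 1 - i) with h | h
  · rw [zigWord_even hi h]; omega
  · rw [zigWord_odd hi h]; omega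

lemma zigWord_inj {r i j : ℕ} (hi : i < r) (hj : j < r) (h : zigWord r i = zigWord r j) :
    i = j := by
  rcases Nat.eq_zero_or_pos i with rfl | hi0 <;> rcases Nat.eq_zero_or_pos j with rfl | hj0
  · rfl
  · have := zigWord_pos hj0 hj
    rw [zigWord_zero] at h; omega
  · have := zigWord_pos hi0 hi
    rw [zigWord_zero] at h; omega
  · rcases Nat.lt_trichotomy i j with hij | hij | hij
    · rcases Nat.mod_two_eq_zero_or_one (r - 1 - j) with h' | h'
      · have := zigWord_of_even hi0 hij hj h'; omega
      · have := zigWord_of_odd hi0 hij hj h'; omega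
    · exact hij
    · rcases Nat.mod_two_eq_zero_or_one (r - 1 - i) with h' | h'
      · have := zigWord_of_even hj0 hij hi h'; omega
      · have := zigWord_of_odd hj0 hij hi h'; omega

/-- A letter at even distance from the end lies below all earlier nonzero letters, one at odd
distance above them. Moving one step right flips the parity, hence the comparison. -/
lemma zigWord_succ_lt_succ {r i j : ℕ} (hi : 0 < i) (hj : 0 < j) (hir : i + 1 < r)
    (hjr : j + 1 < r) (h : zigWord r i < zigWord r j) :
    zigWord r (j + 1) < zigWord r (i + 1) := by
  rcases Nat.lt_trichotomy i j with hij | rfl | hij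
  · rcases Nat.mod_two_eq_zero_or_one (r - 1 - j) with h' | h'
    · have := zigWord_of_even hi hij (by omega) h'; omega
    · exact zigWord_of_even (by omega) (by omega) hjr (by omega)
  · omega
  · rcases Nat.mod_two_eq_zero_or_one (r - 1 - i) with h' | h'
    · exact zigWord_of_odd (by omega) (by omega) hir (by omega)
    · have := zigWord_of_odd hj hij (by omega) h'; omega

lemma zigWord_cyc {r i j k : ℕ} (hij : i < j) (hjk : j < k) (hk : k < r) :
    ¬ (zigWord r j < zigWord r k ∧ zigWord r k < zigWord r i) := by
  rintro ⟨h1, h2⟩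
  rcases Nat.eq_zero_or_pos i with rfl | hi
  · rw [zigWord_zero] at h2; omega
  rcases Nat.mod_two_eq_zero_or_one (r - 1 - k) with h | h
  · have := zigWord_of_even (by omega) hjk hk h; omega
  · have := zigWord_of_odd hi (by omega : i < k) hk h; omega

/-- A word ending in 1 on which the successor map reverses order is determined: reading backwards,
each letter is alternately the least or the greatest of those left. -/
lemma eq_zigWord {r : ℕ} {c : ℕ → ℕ} (hr : 2 ≤ r)
    (hrange : ∀ i, 0 < i → i < r → 0 < c i ∧ c i < r)
    (hinj : ∀ i j, 0 < i → 0 < j → i < r → j < r → c i = c j → i = j)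
    (hsurj : ∀ x, 0 < x → x < r → ∃ i, 0 < i ∧ i < r ∧ c i = x)
    (hlast : c (r - 1) = 1)
    (hanti : ∀ i j, 0 < i → 0 < j → i + 1 < r → j + 1 < r → c i < c j → c (j + 1) < c (i + 1)) :
    ∀ i, 0 < i → i < r → c i = zigWord r i := by
  have hcomp : ∀ e i j, 0 < i → i < j → j + e = r - 1 →
      (e % 2 = 0 → c j < c i) ∧ (e % 2 = 1 → c i < c j) := by
    intro e
    induction e with
    | zero =>
      intro i j hi hij hj
      obtain rfl : j = r - 1 := by omega
      have := (hrange i hi (by omega)).1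
      have : c i ≠ c (r - 1) := fun h => by
        have := hinj i (r - 1) hi (by omega) (by omega) (by omega) h
        omega
      omega
    | succ e ih =>
      intro i j hi hij hj
      have h1 := ih (i + 1) (j + 1) (by omega) (by omega) (by omega)
      have h2 : c i ≠ c j := fun h => by
        have := hinj i j hi (by omega) (by omega) (by omega) h
        omega
      have h3 := hanti i j hi (by omega) (by omega) (by omega)
      have h4 := hanti j i (by omega) hi (by omega) (by omega)
      omega
  have key : ∀ e, e + 1 < r → c (r - 1 - e) = zigWord r (r - 1 - e) := by
    intro e
    induction e using Nat.strong_induction_on with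
    | _ e ih =>
      intro he
      have ih' : ∀ j, r - 1 - e < j → j < r → c j = zigWord r j := by
        intro j h1 h2
        have := ih (r - 1 - j) (by omega) (by omega)
        rwa [show r - 1 - (r - 1 - j) = j by omega] at this
      set J := r - 1 - e with hJ
      obtain ⟨i, hi0, hir, hi⟩ := hsurj (zigWord r J) (zigWord_pos (by omega) (by omega))
        (zigWord_lt (by omega))
      rcases Nat.lt_trichotomy i J with hlt | rfl | hgt
      · exfalso
        have hc := hcomp e i J hi0 hlt (by omega)
        have hJr := hrange J (by omega) (by omega)
        rcases Nat.mod_two_eq_zero_or_one e with h | h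
        · have hz := zigWord_even (r := r) (i := J) (by omega) (by omega)
          have hcJ := hc.1 h
          -- A letter c J smaller than the expected one has already been placed further right, at
          -- this index; the odd case is symmetric.
          have hi' := ih' (r - 1 - 2 * (c J - 1)) (by omega) (by omega)
          rw [zigWord_even (by omega) (by omega)] at hi'
          have := hinj _ J (by omega) (by omega) (by omega) (by omega)
            (hi'.trans (by omega : _ = c J))
          omega
        · have hz := zigWord_odd (r := r) (i := J) (by omega) (by omega)
          have hcJ := hc.2 h
          have hi' := ih' (r - 1 - (2 * (r - 1 - c J) + 1)) (by omega) (by omega)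
          rw [zigWord_odd (by omega) (by omega)] at hi'
          have := hinj _ J (by omega) (by omega) (by omega) (by omega)
            (hi'.trans (by omega : _ = c J))
          omega
      · exact hi
      · exfalso
        rw [ih' i hgt hir] at hi
        have := zigWord_inj hir (by omega) hi
        omega
  intro i hi hir
  have := key (r - 1 - i) (by omega)
  rwa [show r - 1 - (r - 1 - i) = i by omega] at this

/-! ### One-line pattern 312 -/

section Pattern312

lemma IsAvoidingWord.apply_last_of_312 {n : ℕ} {c : ℕ → ℕ} (h : IsAvoidingWord Ord312 n c)
    (hn : 1 ≤ n) : c (n - 1) = n - 1 := by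
  by_contra hm
  have hmn := h.lt (n - 1) (by omega)
  have hz := h.zero
  have hend : c (n - 1 + 1) = 0 := h.tail _ (by omega)
  obtain ⟨j, hj, hcj⟩ := h.exists_eq (x := n - 1) (by omega)
  have hj1 : j ≠ n - 1 := by rintro rfl; omega
  obtain ⟨y, hjy, hyn, hy, hy1⟩ := exists_crossing (fun i => c (n - 1) < c i) (a := j)
    (b := n - 1) (by omega) (by omega) (by simp)
  simp only [not_lt] at hy hy1
  have hy0 := h.pos (by omega : 0 < y + 1) (by omega)
  -- With m the last letter and c y > m ≥ c (y + 1), the images c (i + 1), 0, c (y + 1) of c i < m <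
  -- c y force c (i + 1) < m. So the walk from 0 could never reach m.
  have key : ∀ i, i ≤ n - 1 → c i < c (n - 1) := by
    intro i
    induction i with
    | zero =>
      intro _
      have := h.pos (by omega : 0 < n - 1) (by omega)
      omega
    | succ i ih =>
      intro hi
      have h1 := h.oneLine i (n - 1) y (by omega) (by omega) (by omega) (ih (by omega)) hy
      simp only [Ord312] at h1
      have h2 := h.ne (by omega : i + 1 < n) (by omega : y + 1 < n) (by
        rintro e
        obtain rfl : i = y := by omega
        have := ih (by omega)
        omega)
      omega
  exact lt_irrefl _ (key _ le_rfl)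

/-- The zigzag word of length `r` followed by the word `c` of length `n`, shifted by `r`. -/
def zigSum (r n : ℕ) (c : ℕ → ℕ) (i : ℕ) : ℕ :=
  if i < r then zigWord r i else if i < r + n then r + c (i - r) else 0

lemma zigSum_of_lt {r n i : ℕ} (c : ℕ → ℕ) (h : i < r) : zigSum r n c i = zigWord r i := if_pos h

lemma zigSum_add {r n i : ℕ} (c : ℕ → ℕ) (h : i < n) : zigSum r n c (r + i) = r + c i := by
  rw [zigSum, if_neg (by omega), if_pos (by omega)]; simp

lemma zigSum_end {r n : ℕ} (c : ℕ → ℕ) : zigSum r n c (r + n) = 0 := by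
  rw [zigSum, if_neg (by omega), if_neg (by omega)]

/-- Images of zigzag letters are at most r, and nonzero images of shifted letters exceed r. So an
occurrence lies in one part, where it is excluded by order reversal or by the hypothesis on c. -/
lemma isAvoidingWord_zigSum {r n : ℕ} {c : ℕ → ℕ} (hr : 0 < r) (hn : 0 < n)
    (hc : IsAvoidingWord Ord312 n c) : IsAvoidingWord Ord312 (r + n) (zigSum r n c) := by
  have hlow : ∀ i, i < r → zigSum r n c i = zigWord r i ∧ zigWord r i < r :=
    fun i hi => ⟨zigSum_of_lt c hi, zigWord_lt hi⟩
  have hhigh : ∀ i, r ≤ i → i < r + n → ∃ i', i = r + i' ∧ i' < n ∧ c i' < n ∧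
      zigSum r n c i = r + c i' := by
    intro i hi hin
    obtain ⟨i', rfl⟩ := Nat.exists_eq_add_of_le hi
    exact ⟨i', rfl, by omega, hc.lt i' (by omega), zigSum_add c (by omega)⟩
  have hlast := IsAvoidingWord.apply_last_of_312 hc hn
  have hz := hc.zero
  refine ⟨⟨?_, ?_, ?_, ?_⟩, ?_, ?_⟩
  · rw [zigSum_of_lt c hr, zigWord_zero]
  · intro i hi
    rw [zigSum, if_neg (by omega), if_neg (by omega)]
  · intro i hi
    rcases Nat.lt_or_ge i r with h | h
    · have := hlow i h; omega
    · obtain ⟨i', -, -, h1, h2⟩ := hhigh i h hi; omega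
  · intro i j hi hj h
    rcases Nat.lt_or_ge i r with hir | hir <;> rcases Nat.lt_or_ge j r with hjr | hjr
    · rw [zigSum_of_lt c hir, zigSum_of_lt c hjr] at h
      exact zigWord_inj hir hjr h
    · have := hlow i hir
      obtain ⟨j', -, -, -, h2⟩ := hhigh j hjr hj; omega
    · have := hlow j hjr
      obtain ⟨i', -, -, -, h2⟩ := hhigh i hir hi; omega
    · obtain ⟨i', hi', h1, -, h2⟩ := hhigh i hir hi
      obtain ⟨j', hj', h3, -, h4⟩ := hhigh j hjr hj
      have := hc.inj i' j' h1 h3 (by omega)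
      omega
  · intro i j k hij hjk hk
    rcases Nat.lt_or_ge i r with hir | hir
    · rcases Nat.lt_or_ge k r with hkr | hkr
      · rw [zigSum_of_lt c hir, zigSum_of_lt c hkr, zigSum_of_lt c (hjk.trans hkr)]
        exact zigWord_cyc hij hjk hkr
      · have := hlow i hir
        obtain ⟨k', -, -, -, h2⟩ := hhigh k hkr hk; omega
    · obtain ⟨i', rfl, -, -, h1⟩ := hhigh i hir (by omega)
      obtain ⟨j', rfl, -, -, h2⟩ := hhigh j (by omega) (by omega)
      obtain ⟨k', rfl, -, -, h3⟩ := hhigh k (by omega) hk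
      have := hc.cyc i' j' k' (by omega) (by omega) (by omega)
      omega
  · intro i j k hi hj hk hij hjk
    simp only [Ord312]
    rintro ⟨h1, h2⟩
    have hsucc : ∀ i, i < r → zigSum r n c (i + 1) ≤ r := by
      intro i hi
      rcases Nat.eq_or_lt_of_le (Nat.succ_le_of_lt hi) with e | h
      · rw [Nat.succ_eq_add_one] at e
        rw [e, ← Nat.add_zero r, zigSum_add c hn, hz]
      · exact (by have := hlow (i + 1) h; omega)
    rcases Nat.lt_or_ge k r with hkr | hkr
    · have hk1 := hlow k hkr
      have hjr : j < r := by
        by_contra hjr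
        obtain ⟨j', -, -, -, h⟩ := hhigh j (by omega) hj; omega
      have hj0 : 0 < j := by
        rcases Nat.eq_zero_or_pos j with rfl | h
        · rw [zigSum_of_lt c hr, zigWord_zero] at hij; omega
        · exact h
      have hk0 : 0 < k := by
        rcases Nat.eq_zero_or_pos k with rfl | h
        · rw [zigSum_of_lt c hr, zigWord_zero] at hjk; omega
        · exact h
      have hj2 := zigWord_pos hj0 hjr
      have hj1 := hlow j hjr
      have hk2 : k + 1 ≠ r := by
        intro e
        have := zigWord_last (r := r) (by omega)
        rw [show r - 1 = k by omega] at this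
        omega
      have hj3 : j + 1 ≠ r := by
        intro e
        have e1 : zigSum r n c (j + 1) = r := by
          rw [e]; simpa [hz] using zigSum_add (r := r) c hn
        have := hlow (k + 1) (by omega)
        omega
      have h3 := hlow (j + 1) (by omega)
      have h4 := hlow (k + 1) (by omega)
      have := zigWord_succ_lt_succ hj0 hk0 (by omega) (by omega)
        (by omega : zigWord r j < zigWord r k)
      omega
    · obtain ⟨k', rfl, hk', -, hk2⟩ := hhigh k hkr hk
      have hk1 : k' + 1 < n := by
        by_contra hcon
        rw [show r + k' + 1 = r + n by omega, zigSum_end] at h1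
        omega
      have hk3 := zigSum_add (r := r) c hk1
      rw [← Nat.add_assoc] at hk3
      have hk4 := hc.pos (by omega : 0 < k' + 1) hk1
      rcases Nat.lt_or_ge i r with hir | hir
      · have := hsucc i hir
        omega
      · obtain ⟨i', rfl, hi', -, hi2⟩ := hhigh i hir hi
        have hjr : r ≤ j := by
          by_contra hjr
          have := hlow j (by omega)
          omega
        obtain ⟨j', rfl, hj', -, hj2⟩ := hhigh j hjr hj
        have hsub : ∀ i, i < n → c i < c k' → zigSum r n c (r + i + 1) = r + c (i + 1) := by
          intro i hi hik
          refine zigSum_add (r := r) (i := i + 1) c ?_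
          by_contra hcon
          have := hc.lt k' hk'
          rw [show i = n - 1 by omega] at hik
          omega
        have h3 := hsub i' hi' (by omega)
        have h4 := hsub j' hj' (by omega)
        refine hc.oneLine i' j' k' hi' hj' hk' (by omega) (by omega) ⟨?_, ?_⟩ <;> omega

lemma exists_zigSum_eq {r n : ℕ} {d : ℕ → ℕ} (hd : IsAvoidingWord Ord312 (r + n) d)
    (hr : d r = r) (hlow : ∀ i, i < r → d i = zigWord r i)
    (hhigh : ∀ i, r ≤ i → i < r + n → r ≤ d i) :
    ∃ c, IsAvoidingWord Ord312 n c ∧ zigSum r n c = d := by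
  have hge : ∀ i, i < n → r ≤ d (r + i) := fun i hi => hhigh _ (by omega) (by omega)
  refine ⟨fun i => d (r + i) - r, ⟨⟨by simp [hr], ?_, ?_, ?_⟩, ?_, ?_⟩, ?_⟩
  · intro i hi
    rw [hd.tail _ (by omega)]; omega
  · intro i hi
    have := hd.lt (r + i) (by omega)
    omega
  · intro i j hi hj h
    have := hge i hi
    have := hge j hj
    have := hd.inj (r + i) (r + j) (by omega) (by omega) (by omega)
    omega
  · intro i j k hij hjk hk
    have := hd.cyc (r + i) (r + j) (r + k) (by omega) (by omega) (by omega)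
    omega
  · intro i j k hi hj hk hij hjk
    have := hd.oneLine (r + i) (r + j) (r + k) (by omega) (by omega) (by omega) (by omega)
      (by omega)
    simp only [Ord312, ← Nat.add_assoc] at this ⊢
    omega
  · funext i
    rw [zigSum]
    split_ifs with h1 h2
    · exact (hlow i h1).symm
    · have := hhigh i (by omega) h2
      rw [show r + (i - r) = i by omega]
      omega
    · rw [hd.tail i (by omega)]

lemma IsAvoidingWord.eq_zigSum_of_312 {n : ℕ} {d : ℕ → ℕ} (h : IsAvoidingWord Ord312 (n + 2) d) :
    ∃ j ∈ insert (n + 1) (Finset.Ico 1 n), ∃ c, IsAvoidingWord Ord312 j c ∧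
      zigSum (n + 2 - j) j c = d := by
  have hz := h.zero
  by_cases h1 : d 1 = 1
  · refine ⟨n + 1, by simp, ?_⟩
    have e : n + 2 - (n + 1) = 1 := by omega
    rw [e]
    refine exists_zigSum_eq (by rwa [show 1 + (n + 1) = n + 2 by omega]) h1 ?_ ?_
    · intro i hi
      rw [show i = 0 by omega, hz, zigWord_zero]
    · intro i hi hin
      exact h.pos (by omega) (by omega)
  have hlast := IsAvoidingWord.apply_last_of_312 h (by omega)
  rw [show n + 2 - 1 = n + 1 by omega] at hlast
  obtain ⟨t, ht, hdt⟩ := h.exists_succ_eq (x := 1) (by omega) (by omega)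
  have ht0 : t ≠ 0 := by rintro rfl; exact h1 hdt
  have htn : t ≠ n := by rintro rfl; omega
  have hk := h.pos (by omega : 0 < 1) (by omega)
  have hbig : ∀ i, t + 1 < i → i < n + 2 → d 1 < d i := fun i => h.apply_one_lt_of_lt hdt
  have hb := hbig (t + 2) (by omega) (by omega)
  have hleft : ∀ i, i ≤ t + 1 → d i < d (t + 2) := by
    intro i hi
    rcases Nat.eq_or_lt_of_le hi with rfl | hi
    · omega
    · have := h.cyc i (t + 1) (t + 2) hi (by omega) (by omega)
      have := h.ne (by omega : i < n + 2) (by omega : t + 2 < n + 2) (by omega)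
      omega
  have hx1 := h.pos (by omega : 0 < t) (by omega)
  have hx2 := h.ne (by omega : t < n + 2) (by omega : t + 1 < n + 2) (by omega)
  -- A drop below b = d (t + 2) after the letter d i would give 1 < d t < d i the images b, 1, d (i
  -- + 1), a 312. Hence the letters before b are exactly those below b.
  have hright : ∀ i, t + 2 ≤ i → i < n + 2 → d (t + 2) ≤ d i := by
    intro i hi
    induction i, hi using Nat.le_induction with
    | base => exact fun _ => le_rfl
    | succ i hi ih =>
      intro hin
      have ih := ih (by omega)
      by_contra hcon
      have h2 := hbig (i + 1) (by omega) hin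
      have h3 := h.oneLine (t + 1) t i (by omega) (by omega) (by omega) (by omega)
        (by have := hleft t (by omega); omega)
      simp only [Ord312] at h3
      rw [show t + 1 + 1 = t + 2 by omega] at h3
      omega
  have hbt : d (t + 2) = t + 2 := by
    have hbn := h.lt (t + 2) (by omega)
    have himg : (Finset.range (t + 2)).image d = Finset.range (d (t + 2)) := by
      ext x
      simp only [Finset.mem_image, Finset.mem_range]
      constructor
      · rintro ⟨i, hi, rfl⟩
        exact hleft i (by omega)
      · intro hx
        obtain ⟨i, hi, rfl⟩ := h.exists_eq (x := x) (by omega)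
        refine ⟨i, ?_, rfl⟩
        by_contra hcon
        have := hright i (by omega) hi
        omega
    have hcard := congrArg Finset.card himg
    rw [Finset.card_image_of_injOn, Finset.card_range, Finset.card_range] at hcard
    · exact hcard.symm
    · intro i hi j hj hij
      simp only [Finset.coe_range, Set.mem_Iio] at hi hj
      exact h.inj i j (by omega) (by omega) hij
  rw [hbt] at hleft hright
  refine ⟨n - t, by simp; omega, ?_⟩
  rw [show n + 2 - (n - t) = t + 2 by omega]
  refine exists_zigSum_eq (by rwa [show t + 2 + (n - t) = n + 2 by omega]) hbt ?_ ?_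
  · intro i hi
    rcases Nat.eq_zero_or_pos i with rfl | hi0
    · rw [hz, zigWord_zero]
    refine eq_zigWord (by omega) ?_ ?_ ?_ hdt ?_ i hi0 hi
    · intro i hi0 hi
      exact ⟨h.pos hi0 (by omega), hleft i (by omega)⟩
    · intro i j _ _ hi hj
      exact h.inj i j (by omega) (by omega)
    · intro x hx hxr
      obtain ⟨i, hi, rfl⟩ := h.exists_succ_eq (x := x) hx (by omega)
      refine ⟨i + 1, by omega, ?_, rfl⟩
      by_contra hcon
      have := hright (i + 1) (by omega) hi
      omega
    · intro i j hi hj hir hjr hij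
      have h2 := h.pos hi (by omega)
      have h3 := h.ne (by omega : i < n + 2) (by omega : t + 1 < n + 2) (by omega)
      have h4 := h.oneLine (t + 1) i j (by omega) (by omega) (by omega) (by omega) hij
      have h5 := hleft (j + 1) (by omega)
      have h6 := h.ne (by omega : i + 1 < n + 2) (by omega : j + 1 < n + 2) (by
        rintro e; rw [show i = j by omega] at hij; omega)
      simp only [Ord312] at h4
      rw [show t + 1 + 1 = t + 2 by omega] at h4
      omega
  · intro i hi hin
    exact hright i hi (by omega)

lemma zigSum_injOn (r n : ℕ) : Set.InjOn (zigSum r n) {c | IsCycleWord n c} := by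
  intro c hc d hd h
  funext i
  by_cases hi : i < n
  · have := congrFun h (r + i)
    rw [zigSum_add c hi, zigSum_add d hi] at this
    omega
  · rw [hc.tail i (by omega), hd.tail i (by omega)]

/-- The term j = n is absent: a zigzag block of length 2 is 0, 1, and such words are already counted
with the block 0 of length 1. Disjointness is read off from the position of the letter 1. -/
lemma ncard_setOf_isAvoidingWord_312_add_two (n : ℕ) :
    {c | IsAvoidingWord Ord312 (n + 2) c}.ncard =
      {c | IsAvoidingWord Ord312 (n + 1) c}.ncard +
        ∑ j ∈ Finset.Ico 1 n, {c | IsAvoidingWord Ord312 j c}.ncard := by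
  classical
  let W : ℕ → Finset (ℕ → ℕ) := fun n => (finite_setOf_isAvoidingWord Ord312 n).toFinset
  have hW : ∀ n c, c ∈ W n ↔ IsAvoidingWord Ord312 n c := fun n c => by simp [W]
  have hcard : ∀ n, {c | IsAvoidingWord Ord312 n c}.ncard = (W n).card := fun n =>
    Set.ncard_eq_toFinset_card _ _
  have hunion : W (n + 2) = (insert (n + 1) (Finset.Ico 1 n)).biUnion
      fun j => (W j).image (zigSum (n + 2 - j) j) := by
    ext d
    simp only [Finset.mem_biUnion, Finset.mem_image, hW]
    constructor
    · exact fun h => IsAvoidingWord.eq_zigSum_of_312 h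
    · rintro ⟨j, hj, c, hc, rfl⟩
      simp only [Finset.mem_insert, Finset.mem_Ico] at hj
      have := isAvoidingWord_zigSum (r := n + 2 - j) (by omega) (by omega) hc
      rwa [show n + 2 - j + j = n + 2 by omega] at this
  have hone : ∀ j ∈ insert (n + 1) (Finset.Ico 1 n), ∀ c, IsAvoidingWord Ord312 j c →
      zigSum (n + 2 - j) j c (if j = n + 1 then 1 else n + 1 - j) = 1 := by
    intro j hj c hc
    simp only [Finset.mem_insert, Finset.mem_Ico] at hj
    split_ifs with e
    · subst e
      have := zigSum_add (r := 1) (n := n + 1) (i := 0) c (by omega)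
      rw [hc.zero] at this
      rwa [show n + 2 - (n + 1) = 1 by omega]
    · rw [zigSum_of_lt c (by omega), show n + 1 - j = n + 2 - j - 1 by omega]
      exact zigWord_last (by omega)
  simp only [hcard]
  rw [hunion, Finset.card_biUnion, Finset.sum_insert (by simp)]
  · have himg : ∀ j r, ((W j).image (zigSum r j)).card = (W j).card := by
      intro j r
      refine Finset.card_image_of_injOn ((zigSum_injOn r j).mono fun c hc => ?_)
      exact ((hW j c).1 hc).toIsCycleWord
    simp only [himg]
  · intro j hj k hk hjk
    rw [Function.onFun, Finset.disjoint_left]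
    intro d hd hd'
    obtain ⟨c, hc, rfl⟩ := Finset.mem_image.1 hd
    obtain ⟨c', hc', e⟩ := Finset.mem_image.1 hd'
    rw [hW] at hc hc'
    have h1 := hone j hj c hc
    have h2 := hone k hk c' hc'
    rw [e] at h2
    simp only [Finset.mem_coe, Finset.mem_insert, Finset.mem_Ico] at hj hk
    have hw := isAvoidingWord_zigSum (r := n + 2 - j) (by omega) (by omega) hc
    have := hw.inj _ _ (by split_ifs <;> omega) (by split_ifs <;> omega) (h1.trans h2.symm)
    split_ifs at this <;> omega

lemma ncard_setOf_isAvoidingWord_312_rec (n : ℕ) :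
    {c | IsAvoidingWord Ord312 (n + 4) c}.ncard + {c | IsAvoidingWord Ord312 (n + 2) c}.ncard =
      2 * {c | IsAvoidingWord Ord312 (n + 3) c}.ncard +
        {c | IsAvoidingWord Ord312 (n + 1) c}.ncard := by
  have h1 := ncard_setOf_isAvoidingWord_312_add_two (n + 2)
  have h2 := ncard_setOf_isAvoidingWord_312_add_two (n + 1)
  rw [Finset.sum_Ico_succ_top (by omega)] at h1
  simp only [show n + 2 + 2 = n + 4 by omega, show n + 2 + 1 = n + 3 by omega,
    show n + 1 + 1 = n + 2 by omega] at h1 h2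
  omega

/-- The sum of the binomial coefficients `C(m - k, 2 k)`. -/
def chooseSum (m : ℕ) : ℕ := ∑ k ∈ Finset.range (m / 3 + 1), Nat.choose (m - k) (2 * k)

lemma chooseSum_eq {m K : ℕ} (hK : m / 3 + 1 ≤ K) :
    chooseSum m = ∑ k ∈ Finset.range K, Nat.choose (m - k) (2 * k) := by
  refine Finset.sum_subset (Finset.range_mono hK) fun k _ hk => ?_
  rw [Finset.mem_range] at hk
  exact Nat.choose_eq_zero_of_lt (by omega)

/-- The second difference of C(x, 2k + 2) in x is C(x, 2k). -/
lemma choose_rec (m k : ℕ) :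
    (m + 2 - k).choose (2 * k + 2) + (m - k).choose (2 * k + 2) =
      2 * (m + 1 - k).choose (2 * k + 2) + (m - k).choose (2 * k) := by
  rcases Nat.lt_or_ge m k with h | h
  · rw [Nat.choose_eq_zero_of_lt (by omega : m + 2 - k < 2 * k + 2),
      Nat.choose_eq_zero_of_lt (by omega : m - k < 2 * k + 2),
      Nat.choose_eq_zero_of_lt (by omega : m + 1 - k < 2 * k + 2),
      Nat.choose_eq_zero_of_lt (by omega : m - k < 2 * k)]
  · obtain ⟨a, rfl⟩ := Nat.exists_eq_add_of_le h
    rw [show k + a + 2 - k = a + 1 + 1 by omega, show k + a + 1 - k = a + 1 by omega,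
      show k + a - k = a by omega, Nat.choose_succ_succ' (a + 1) (2 * k + 1),
      Nat.choose_succ_succ' a (2 * k + 1), Nat.choose_succ_succ' a (2 * k)]
    ring

lemma chooseSum_rec (m : ℕ) :
    chooseSum (m + 3) + chooseSum (m + 1) = 2 * chooseSum (m + 2) + chooseSum m := by
  rw [chooseSum_eq (m := m + 3) (K := m + 3 + 1) (by omega),
    chooseSum_eq (m := m + 2) (K := m + 3 + 1) (by omega),
    chooseSum_eq (m := m + 1) (K := m + 3 + 1) (by omega),
    chooseSum_eq (m := m) (K := m + 3) (by omega)]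
  simp only [Finset.sum_range_succ' _ (m + 3)]
  have h := Finset.sum_congr (rfl : Finset.range (m + 3) = Finset.range (m + 3))
    fun k _ => choose_rec m k
  rw [Finset.sum_add_distrib, Finset.sum_add_distrib, ← Finset.mul_sum] at h
  simp only [show ∀ k, m + 3 - (k + 1) = m + 2 - k from fun k => by omega,
    show ∀ k, m + 2 - (k + 1) = m + 1 - k from fun k => by omega,
    show ∀ k, m + 1 - (k + 1) = m - k from fun k => by omega,
    show ∀ k, 2 * (k + 1) = 2 * k + 2 from fun k => by omega, mul_zero, Nat.choose_zero_right]
  omega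

lemma ncard_setOf_isAvoidingWord_312 (n : ℕ) :
    {c | IsAvoidingWord Ord312 (n + 1) c}.ncard = chooseSum n := by
  induction n using Nat.strong_induction_on with
  | _ n ih =>
    rcases n with _ | _ | _ | n
    · rw [setOf_isAvoidingWord_one, Set.ncard_singleton]; rfl
    · rw [setOf_isAvoidingWord_two, Set.ncard_singleton]; rfl
    · have := ncard_setOf_isAvoidingWord_312_add_two 1
      simp only [Nat.reduceAdd, setOf_isAvoidingWord_two, Set.ncard_singleton, Finset.Ico_self,
        Finset.sum_empty] at this
      exact this
    · have h1 := ncard_setOf_isAvoidingWord_312_rec n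
      have h2 := chooseSum_rec n
      have h3 := ih n (by omega)
      have h4 := ih (n + 1) (by omega)
      have h5 := ih (n + 2) (by omega)
      simp only [Nat.add_assoc, Nat.reduceAdd] at *
      omega

end Pattern312

/-! ### One-line pattern 123 -/

section Pattern123

/-- If the predecessor x of the largest letter were not 1, then 0, 1, x would have images c 1, the
successor of 1, and n + 1, a 123. -/
lemma IsAvoidingWord.apply_penultimate_of_123 {n : ℕ} {c : ℕ → ℕ}
    (h : IsAvoidingWord Ord123 (n + 2) c) (hn : 1 ≤ n) (hlast : c (n + 1) = n + 1) : c n = 1 := by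
  have hz := h.zero
  have hk := h.pos (by omega : 0 < 1) (by omega)
  have hkn := h.lt 1 (by omega)
  have hk1 := h.ne (by omega : 1 < n + 2) (by omega : n + 1 < n + 2) (by omega)
  obtain ⟨t, ht, hct⟩ := h.exists_eq (x := 1) (by omega)
  have ht0 : 0 < t := by
    rcases Nat.eq_zero_or_pos t with rfl | h0
    · omega
    · exact h0
  have htn : t ≠ n + 1 := by rintro rfl; omega
  have hb := h.apply_one_lt_of_lt hct (by omega : t < t + 1) (by omega)
  obtain ⟨p, hp, hcp⟩ := h.exists_succ_eq (x := n + 1) (by omega) (by omega)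
  have hp0 : p ≠ 0 := by rintro rfl; exact hk1 (hcp.trans hlast.symm)
  have hpp := h.pos (by omega : 0 < p) (by omega)
  have hpn := h.inj (p + 1) (n + 1) hp (by omega) (by omega)
  have hbn := h.lt (t + 1) (by omega)
  by_cases e : p = t
  · rw [show n = t by omega]; exact hct
  have h1 := h.ne (by omega : p < n + 2) (by omega : t < n + 2) e
  have h2 := h.ne (by omega : t + 1 < n + 2) hp (by omega)
  have h3 := h.oneLine 0 t p (by omega) (by omega) (by omega) (by omega) (by omega)
  simp only [Ord123, zero_add] at h3
  omega

/-- The word `0, n - 3, n - 4, …, 1, n - 1, n - 2`. -/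
def excWord (n i : ℕ) : ℕ :=
  if i = 0 ∨ n ≤ i then 0 else if i = n - 1 then n - 2 else if i = n - 2 then n - 1 else n - 2 - i

/-- The last letter m maps to 0, so the map reverses order on the letters above m. If the maximum
were earlier, its next two letters would increase and form a 312 with it. -/
lemma IsAvoidingWord.apply_penultimate_of_123' {n : ℕ} {c : ℕ → ℕ}
    (h : IsAvoidingWord Ord123 (n + 2) c) (h1 : c (n + 1) ≠ 1) (h2 : c (n + 1) ≠ n + 1) :
    c n = n + 1 := by
  have hz := h.zero
  have hm0 := h.pos (by omega : 0 < n + 1) (by omega)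
  have hmn := h.lt (n + 1) (by omega)
  have hend : c (n + 1 + 1) = 0 := h.apply_end
  have hdec : ∀ i j, i < n + 1 → j < n + 1 → c (n + 1) < c i → c i < c j →
      c (j + 1) < c (i + 1) := by
    intro i j hi hj hmi hij
    have := h.oneLine (n + 1) i j (by omega) (by omega) (by omega) hmi hij
    have := h.pos (by omega : 0 < i + 1) (by omega)
    have := h.ne (by omega : i + 1 < n + 2) (by omega : j + 1 < n + 2) (by
      intro e; rw [show i = j by omega] at hij; omega)
    simp only [Ord123] at *
    omega
  obtain ⟨s, hs, hcs⟩ := h.exists_eq (x := n + 1) (by omega)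
  have hs1 : s ≠ n + 1 := by rintro rfl; exact h2 hcs
  by_contra hne
  have hsn : s ≠ n := by rintro rfl; exact hne hcs
  have h3 := h.cyc s (s + 1) (n + 1) (by omega) (by omega) (by omega)
  have h4 := h.ne (by omega : s + 1 < n + 2) (by omega : n + 1 < n + 2) (by omega)
  have h5 := h.ne (by omega : s + 1 < n + 2) hs (by omega)
  have h6 := h.lt (s + 1) (by omega)
  have h7 := hdec (s + 1) s (by omega) (by omega) (by omega) (by omega)
  have h8 := h.cyc s (s + 1) (s + 2) (by omega) (by omega) (by omega)
  have h9 := h.lt (s + 2) (by omega)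
  have h10 := h.ne (by omega : s + 2 < n + 2) hs (by omega)
  rw [show s + 1 + 1 = s + 2 by omega] at h7
  omega

lemma IsAvoidingWord.eq_excWord_of_123 {n : ℕ} {c : ℕ → ℕ} (h : IsAvoidingWord Ord123 (n + 2) c)
    (h1 : c (n + 1) ≠ 1) (h2 : c (n + 1) ≠ n + 1) :
    (n = 2 ∨ n = 3) ∧ c = excWord (n + 2) := by
  have hz := h.zero
  have hm0 := h.pos (by omega : 0 < n + 1) (by omega)
  have hmn := h.lt (n + 1) (by omega)
  have hend : c (n + 1 + 1) = 0 := h.apply_end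
  have hpen := IsAvoidingWord.apply_penultimate_of_123' h h1 h2
  have hn : 2 ≤ n := by
    rcases n with _ | _ | n
    · omega
    · omega
    · omega
  have hk := h.pos (by omega : 0 < 1) (by omega)
  have hkm := h.ne (by omega : 1 < n + 2) (by omega : n + 1 < n + 2) (by omega)
  -- The maximum maps to the last letter m and m maps to 0, so a letter above m with image in (0, m)
  -- would complete a 123. Hence nonzero letters below m have predecessors below m.
  have hafter : ∀ i, i ≤ n → c (n + 1) < c i → c (n + 1) ≤ c (i + 1) := by
    intro i hi hmi
    rcases Nat.eq_or_lt_of_le hi with rfl | hi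
    · exact le_rfl
    have h3 := h.lt i (by omega)
    have h4 := h.ne (by omega : i < n + 2) (by omega : n < n + 2) (by omega)
    have h5 := h.pos (by omega : 0 < i + 1) (by omega)
    have h6 := h.oneLine (n + 1) i n (by omega) (by omega) (by omega) hmi (by omega)
    simp only [Ord123] at h6
    omega
  have hback : ∀ i, i ≤ n → 0 < c (i + 1) → c (i + 1) < c (n + 1) → c i < c (n + 1) := by
    intro i hi h0 hlt
    have h3 := hafter i hi
    have h4 := h.ne (by omega : i < n + 2) (by omega : n + 1 < n + 2) (by omega)
    omega
  obtain ⟨t, ht, hct⟩ := h.exists_succ_eq (x := 1) (by omega) (by omega)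
  have htn : t ≠ n := by rintro rfl; exact h1 hct
  have hkm' : c 1 < c (n + 1) := by
    by_contra hcon
    have key : ∀ e, e ≤ t + 1 → 0 < t + 1 - e ∧ c (t + 1 - e) < c (n + 1) := by
      intro e
      induction e with
      | zero => intro _; rw [Nat.sub_zero]; omega
      | succ e ih =>
        intro he
        have ih := ih (by omega)
        have h3 : t + 1 - e ≠ 1 := by intro e'; rw [e'] at ih; omega
        refine ⟨by omega, hback _ (by omega) ?_ ?_⟩
        · exact h.pos (by omega) (by omega)
        · rw [show t + 1 - (e + 1) + 1 = t + 1 - e by omega]; exact ih.2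
    have := (key (t + 1) le_rfl).1
    omega
  obtain ⟨i, -, hin, hi, hi1⟩ := exists_crossing (fun i => c i < c (n + 1)) (a := 1) (b := n)
    (by omega) hkm' (by omega)
  simp only [not_lt] at hi hi1
  have hstay : ∀ j, i + 1 ≤ j → j ≤ n + 1 → c (n + 1) ≤ c j := by
    intro j hj
    induction j, hj using Nat.le_induction with
    | base => exact fun _ => hi1
    | succ j hj ih =>
      intro hjn
      by_contra hcon
      have := hback j (by omega) (h.pos (by omega) (by omega)) (by omega)
      have := ih (by omega)
      omega
  have hbig : ∀ x y, 0 < x → x ≤ n + 1 → y ≤ n + 1 → c x < c y → c 1 < c (x + 1) →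
      c (y + 1) ≤ c (x + 1) := by
    intro x y hx0 hx hy hxy h3
    have h4 := h.pos hx0 (by omega)
    have h5 := h.oneLine 0 x y (by omega) (by omega) (by omega) (by omega) hxy
    simp only [Ord123, zero_add] at h5
    omega
  have hi0 : i ≠ 0 := by rintro rfl; simp at hi1; omega
  have hin' : i + 1 = n := by
    by_contra hne
    have h3 := h.lt (i + 1) (by omega)
    have h4 := h.ne (by omega : i + 1 < n + 2) (by omega : n < n + 2) hne
    have h5 := hbig i (n - 1) (by omega) (by omega) (by omega)
      (by have := hstay (n - 1) (by omega) (by omega); omega) (by omega)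
    rw [show n - 1 + 1 = n by omega] at h5
    omega
  have hlow : ∀ j, j < n → c j < c (n + 1) := by
    have key : ∀ e, e ≤ i → c (i - e) < c (n + 1) := by
      intro e
      induction e with
      | zero => intro _; exact hi
      | succ e ih =>
        intro he
        have ih := ih (by omega)
        rw [show i - e = i - (e + 1) + 1 by omega] at ih
        exact hback _ (by omega) (h.pos (by omega) (by omega)) ih
    intro j hj
    have := key (i - j) (by omega)
    rwa [show i - (i - j) = j by omega] at this
  have hm : c (n + 1) = n := by
    by_contra hne
    obtain ⟨j, hj, hcj⟩ := h.exists_eq (x := n) (by omega)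
    have hj1 : j ≠ n + 1 := by rintro rfl; exact hne hcj
    have hj2 : j ≠ n := by rintro rfl; omega
    have := hlow j (by omega)
    omega
  rw [hm] at hlow
  have hk1 : c 1 = n - 1 := by
    by_contra hne
    obtain ⟨x, hx, hcx⟩ := h.exists_succ_eq (x := n - 1) (by omega) (by omega)
    have hx0 : x ≠ 0 := by rintro rfl; exact hne hcx
    have hxn : x ≠ n := by rintro rfl; omega
    have hxn' := h.lt x (by omega)
    have h3 := h.ne (by omega : x < n + 2) (by omega : n < n + 2) hxn
    have h4 := hbig x n (by omega) (by omega) (by omega) (by omega) (by omega)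
    omega
  -- For n ≥ 4 the predecessors of 1 and 2 increase, and with the maximum they have images 1, 2, n,
  -- a 123.
  have hn3 : n ≤ 3 := by
    by_contra hcon
    obtain ⟨u, hu, hcu⟩ := h.exists_succ_eq (x := 2) (by omega) (by omega)
    have hu0 : u ≠ 0 := by rintro rfl; rw [zero_add] at hcu; omega
    have hun : u ≠ n := by rintro rfl; omega
    have hut : u < t := by
      by_contra hge
      have h3 : u ≠ t := by rintro rfl; omega
      have := h.apply_one_lt_of_lt hct (by omega : t + 1 < u + 1) (by omega)
      omega
    have htn1 : t + 1 ≠ n := by rintro rfl; omega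
    have h3 := hlow t (by omega)
    have h4 := h.ne (by omega : t < n + 2) (by omega : 1 < n + 2)
    have h5 : c t < c u := h.lt_of_lt_apply_one (by omega) hut (by omega) (by omega)
    have h6 := hlow u (by omega)
    have h7 := h.pos (by omega : 0 < t) (by omega)
    have h8 := h.oneLine t u n (by omega) (by omega) (by omega) h5 (by omega)
    simp only [Ord123] at h8
    omega
  refine ⟨by omega, ?_⟩
  have h22 : n = 3 → c 2 = 1 := by
    rintro rfl
    have h3 := hlow 2 (by omega)
    have h4 := h.pos (by omega : 0 < 2) (by omega)
    have h5 := h.ne (by omega : 2 < 3 + 2) (by omega : 1 < 3 + 2) (by omega)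
    omega
  funext j
  simp only [excWord]
  split_ifs with hj hj1 hj2
  · rcases hj with rfl | hj
    · exact hz
    · exact h.tail j hj
  · rw [show j = n + 1 by omega]; omega
  · rw [show j = n by omega]; omega
  · rcases Nat.lt_or_ge 1 j with hj3 | hj3
    · rw [show j = 2 by omega]
      have := h22 (by omega)
      omega
    · rw [show j = 1 by omega]; omega

lemma isAvoidingWord_excWord {n : ℕ} (hn : n = 2 ∨ n = 3) :
    IsAvoidingWord Ord123 (n + 2) (excWord (n + 2)) := by
  refine ⟨⟨rfl, ?_, ?_, ?_⟩, ?_, ?_⟩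
  · intro i hi
    simp only [excWord]; rw [if_pos (by omega)]
  · intro i hi; simp only [excWord]; split_ifs <;> omega
  · intro i j hi hj; simp only [excWord]; split_ifs <;> omega
  · rintro i j k hij hjk hk
    have : ∀ k < n + 2, ∀ j < k, ∀ i < j, ¬ (excWord (n + 2) j < excWord (n + 2) k ∧
        excWord (n + 2) k < excWord (n + 2) i) := by
      rcases hn with rfl | rfl <;> decide
    exact this k hk j hjk i hij
  · intro i j k hi hj hk hij hjk hp
    have : ∀ i < n + 2, ∀ j < n + 2, ∀ k < n + 2,
        ¬ ((excWord (n + 2) i < excWord (n + 2) j ∧ excWord (n + 2) j < excWord (n + 2) k) ∧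
          excWord (n + 2) (i + 1) < excWord (n + 2) (j + 1) ∧
          excWord (n + 2) (j + 1) < excWord (n + 2) (k + 1)) := by
      rcases hn with rfl | rfl <;> decide
    exact this i hi j hj k hk ⟨⟨hij, hjk⟩, hp⟩

/-- The zigzag word, extended by zeros. -/
def fullZigWord (n i : ℕ) : ℕ := if i < n then zigWord n i else 0

lemma isAvoidingWord_fullZigWord {n : ℕ} (hn : 2 ≤ n) :
    IsAvoidingWord Ord123 n (fullZigWord n) := by
  have hf : ∀ i, i < n → fullZigWord n i = zigWord n i := fun i hi => if_pos hi
  refine ⟨⟨by rw [hf 0 (by omega), zigWord_zero], fun i hi => if_neg (by omega), ?_, ?_⟩, ?_, ?_⟩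
  · intro i hi
    rw [hf i hi]
    exact zigWord_lt hi
  · intro i j hi hj h
    rw [hf i hi, hf j hj] at h
    exact zigWord_inj hi hj h
  · intro i j k hij hjk hk
    rw [hf i (by omega), hf j (by omega), hf k hk]
    exact zigWord_cyc hij hjk hk
  · intro i j k hi hj hk hij hjk
    rintro ⟨h1, h2⟩
    rw [hf i hi, hf j hj] at hij
    rw [hf j hj, hf k hk] at hjk
    have hpos : ∀ i, i < n → 0 < zigWord n i → 0 < i := by
      intro i _ h
      rcases Nat.eq_zero_or_pos i with rfl | h0
      · rw [zigWord_zero] at h; omega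
      · exact h0
    have hlast : ∀ i, i < n → 0 < fullZigWord n (i + 1) → i + 1 < n := by
      intro i _ h
      by_contra hcon
      rw [fullZigWord, if_neg hcon] at h
      omega
    have hj0 := hpos j hj (by omega)
    have hk0 := hpos k hk (by omega)
    have hj1 := hlast j hj (by omega)
    have hk1 := hlast k hk (by omega)
    have := zigWord_succ_lt_succ hj0 hk0 hj1 hk1 hjk
    rw [hf _ hj1, hf _ hk1] at h2
    omega

lemma IsAvoidingWord.eq_fullZigWord_of_123 {n : ℕ} {c : ℕ → ℕ}
    (h : IsAvoidingWord Ord123 n c) (hn : 2 ≤ n) (h1 : c (n - 1) = 1) : c = fullZigWord n := by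
  have hz := h.zero
  have hend : c (n - 1 + 1) = 0 := h.tail _ (by omega)
  funext i
  rw [fullZigWord]
  split_ifs with hi
  · rcases Nat.eq_zero_or_pos i with rfl | hi0
    · rw [hz, zigWord_zero]
    refine eq_zigWord hn ?_ ?_ ?_ h1 ?_ i hi0 hi
    · exact fun i hi0 hi => ⟨h.pos hi0 hi, h.lt i hi⟩
    · exact fun i j _ _ hi hj => h.inj i j hi hj
    · intro x hx hxn
      obtain ⟨i, hi, rfl⟩ := h.exists_succ_eq hx hxn
      exact ⟨i + 1, by omega, hi, rfl⟩
    · intro i j hi hj hin hjn hij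
      have h2 := h.pos hi (by omega)
      have h3 := h.ne (by omega : i < n) (by omega : n - 1 < n) (by omega)
      have h4 := h.oneLine (n - 1) i j (by omega) (by omega) (by omega) (by omega) hij
      have h5 := h.pos (by omega : 0 < i + 1) (by omega)
      have h6 := h.ne (by omega : i + 1 < n) (by omega : j + 1 < n) (by
        intro e; rw [show i = j by omega] at hij; omega)
      simp only [Ord123] at h4
      omega
  · exact h.tail i (by omega)

lemma setOf_isAvoidingWord_123 {n : ℕ} (hn : 1 ≤ n) :
    {c | IsAvoidingWord Ord123 (n + 2) c} =
      insert (fullZigWord (n + 2)) (snocSnocWord n '' {c | IsAvoidingWord Ord123 n c}) ∪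
        {c | (n = 2 ∨ n = 3) ∧ c = excWord (n + 2)} := by
  ext c
  constructor
  · intro h
    by_cases h1 : c (n + 1) = 1
    · exact Or.inl (Or.inl (IsAvoidingWord.eq_fullZigWord_of_123 h (by omega) h1))
    by_cases h2 : c (n + 1) = n + 1
    · exact Or.inl (Or.inr (exists_snocSnocWord_eq hn (fun φ hφ x y z => by
        simp only [Ord123, hφ.lt_iff_lt]; exact id) h
        (IsAvoidingWord.apply_penultimate_of_123 h hn h2) h2))
    · exact Or.inr (IsAvoidingWord.eq_excWord_of_123 h h1 h2)
  · rintro ((rfl | ⟨c, hc, rfl⟩) | ⟨hn, rfl⟩)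
    · exact isAvoidingWord_fullZigWord (by omega)
    · exact isAvoidingWord_snocSnocWord hn (fun φ hφ x y z => by
        simp only [Ord123, hφ.lt_iff_lt]; exact id) (by intro x y; omega)
        (by intro x y z; omega) hc
    · exact isAvoidingWord_excWord hn

lemma ncard_setOf_isAvoidingWord_123_add_two {n : ℕ} (hn : 1 ≤ n) :
    {c | IsAvoidingWord Ord123 (n + 2) c}.ncard =
      {c | IsAvoidingWord Ord123 n c}.ncard + 1 + if n = 2 ∨ n = 3 then 1 else 0 := by
  have hfin := (finite_setOf_isAvoidingWord Ord123 n).image (snocSnocWord n)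
  have hzig : fullZigWord (n + 2) (n + 1) = 1 := by
    rw [fullZigWord, if_pos (by omega)]
    exact zigWord_last (by omega)
  have hexc : {c | (n = 2 ∨ n = 3) ∧ c = excWord (n + 2)}.ncard =
      if n = 2 ∨ n = 3 then 1 else 0 := by
    split_ifs with h
    · simp [h]
    · simp [h]
  have hexcfin : {c | (n = 2 ∨ n = 3) ∧ c = excWord (n + 2)}.Finite :=
    (Set.finite_singleton (excWord (n + 2))).subset fun c hc => hc.2
  have hinj : ({c | IsAvoidingWord Ord123 n c} : Set _) ⊆ {c | IsCycleWord n c} :=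
    fun _ h => h.toIsCycleWord
  rw [setOf_isAvoidingWord_123 hn, Set.ncard_union_eq ?_ (hfin.insert _) hexcfin, hexc,
    Set.ncard_insert_of_notMem ?_ hfin, ((snocSnocWord_injOn n).mono hinj).ncard_image]
  · rintro ⟨c, -, h⟩
    have := congrFun h (n + 1)
    rw [hzig] at this
    simp [snocSnocWord] at this
    omega
  · rw [Set.disjoint_left]
    rintro c hc ⟨hn', rfl⟩
    have he : excWord (n + 2) (n + 1) = n := by
      rw [excWord, if_neg (by omega), if_pos (by omega)]; omega
    rcases hc with h | ⟨c, -, h⟩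
    · rw [h, hzig] at he
      omega
    · have := congrFun h (n + 1)
      rw [he] at this
      simp [snocSnocWord] at this

lemma ncard_setOf_isAvoidingWord_123 (n : ℕ) :
    {c | IsAvoidingWord Ord123 (n + 4) c}.ncard = (n + 5) / 2 + 1 := by
  have h1 : {c | IsAvoidingWord Ord123 1 c}.ncard = 1 := by
    rw [setOf_isAvoidingWord_one, Set.ncard_singleton]
  have h2 : {c | IsAvoidingWord Ord123 2 c}.ncard = 1 := by
    rw [setOf_isAvoidingWord_two, Set.ncard_singleton]
  induction n using Nat.twoStepInduction with
  | zero =>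
    have := ncard_setOf_isAvoidingWord_123_add_two (n := 2) (by omega)
    simp only [Nat.reduceAdd, h2] at this
    simpa using this
  | one =>
    have h3 := ncard_setOf_isAvoidingWord_123_add_two (n := 1) (by omega)
    have := ncard_setOf_isAvoidingWord_123_add_two (n := 3) (by omega)
    simp only [Nat.reduceAdd, h1] at this h3
    rw [h3] at this
    simpa using this
  | more n ih1 ih2 =>
    have := ncard_setOf_isAvoidingWord_123_add_two (n := n + 4) (by omega)
    rw [if_neg (by omega), ih1] at this
    rw [show n + 2 + 4 = n + 4 + 2 by omega, this]
    omega

end Pattern123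

end CyclicAvoid

theorem mainTheorem11 :
    -- the cycle form of the inverse is `(1, cₙ, …, c₂)`, the reversal rotated to start with `1`
    (∀ (n : ℕ) (π : Equiv.Perm (Fin n)), CyclicAvoid.IsCyclic π →
      ∀ i j : Fin n, n ∣ (i : ℕ) + (j : ℕ) →
        CyclicAvoid.cycleForm π⁻¹ i = CyclicAvoid.cycleForm π j) ∧
    -- the symmetry, for patterns `σ` of every length
    (∀ (n k : ℕ) (σ : Equiv.Perm (Fin k)), 1 ≤ n →
      CyclicAvoid.numAvoiders n σ CyclicAvoid.p312 =
        CyclicAvoid.numAvoiders n σ⁻¹ CyclicAvoid.p213) ∧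
    -- the values
    (∀ n : ℕ, 5 ≤ n →
      CyclicAvoid.numAvoiders n CyclicAvoid.p123 CyclicAvoid.p312 = ⌈(n : ℚ) / 2⌉₊ + 1 ∧
      CyclicAvoid.numAvoiders n CyclicAvoid.p132 CyclicAvoid.p312 = n - 1 ∧
      CyclicAvoid.numAvoiders n CyclicAvoid.p213 CyclicAvoid.p312 = Nat.fib n ∧
      CyclicAvoid.numAvoiders n CyclicAvoid.p231 CyclicAvoid.p312 = 1 ∧
      CyclicAvoid.numAvoiders n CyclicAvoid.p312 CyclicAvoid.p312 =
        ∑ k ∈ Finset.range ((n - 1) / 3 + 1), Nat.choose (n - 1 - k) (2 * k) ∧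
      CyclicAvoid.numAvoiders n CyclicAvoid.p321 CyclicAvoid.p312 = 2 ^ (n - 2)) := by
  refine ⟨fun n π hπ i j hij => CyclicAvoid.cycleForm_inv hπ i j hij,
    fun n k σ _ => CyclicAvoid.numAvoiders_p312_eq_p213 n σ, fun n hn => ?_⟩
  rw [CyclicAvoid.numAvoiders_eq_ncard CyclicAvoid.describes_p123,
    CyclicAvoid.numAvoiders_eq_ncard CyclicAvoid.describes_p132,
    CyclicAvoid.numAvoiders_eq_ncard CyclicAvoid.describes_p213,
    CyclicAvoid.numAvoiders_eq_ncard CyclicAvoid.describes_p231,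
    CyclicAvoid.numAvoiders_eq_ncard CyclicAvoid.describes_p312,
    CyclicAvoid.numAvoiders_eq_ncard CyclicAvoid.describes_p321]
  refine ⟨?_, CyclicAvoid.ncard_setOf_isAvoidingWord_132 (by omega), ?_, ?_, ?_,
    CyclicAvoid.ncard_setOf_isAvoidingWord_321 (by omega)⟩
  · obtain ⟨m, rfl⟩ := Nat.exists_eq_add_of_le' (by omega : 4 ≤ n)
    rw [CyclicAvoid.ncard_setOf_isAvoidingWord_123]
    congr 1
    symm
    rw [Nat.ceil_eq_iff (by omega)]
    have h : m + 5 = 2 * ((m + 5) / 2) + (m + 5) % 2 := (Nat.div_add_mod _ _).symm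
    have h' : (m + 5) % 2 < 2 := Nat.mod_lt _ (by omega)
    -- Writing the value as q + 1 removes the truncated subtraction in `Nat.ceil_eq_iff`.
    obtain ⟨q, hq⟩ : ∃ q, (m + 5) / 2 = q + 1 := ⟨(m + 5) / 2 - 1, by omega⟩
    rw [hq] at h ⊢
    have h1 : 2 * q < m + 4 := by omega
    have h2 : m + 4 ≤ 2 * (q + 1) := by omega
    have h1' : (2 * q : ℚ) < ((m + 4 : ℕ) : ℚ) := by exact_mod_cast h1
    have h2' : ((m + 4 : ℕ) : ℚ) ≤ 2 * ((q + 1 : ℕ) : ℚ) := by exact_mod_cast h2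
    rw [Nat.add_sub_cancel]
    constructor <;> linarith
  · obtain ⟨m, rfl⟩ := Nat.exists_eq_add_of_le' (by omega : 2 ≤ n)
    exact CyclicAvoid.ncard_setOf_isAvoidingWord_213 m
  · rw [CyclicAvoid.setOf_isAvoidingWord_231 (by omega), Set.ncard_singleton]
  · obtain ⟨m, rfl⟩ := Nat.exists_eq_add_of_le' (by omega : 1 ≤ n)
    exact CyclicAvoid.ncard_setOf_isAvoidingWord_312 m
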